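/- Let $d\in\mathbb N$, let $\mathcal P_2(\mathbb R^d)$ be the set of Borel probability measures on $\mathbb R^d$ with finite second moment, equipped with the $2$-Wasserstein distance $W_2$, let $\lambda$ be Lebesgue measure, and let $\mathcal P_2^\lambda(\mathbb R^d)=\{\mu\in\mathcal P_2(\mathbb R^d):\mu\ll\lambda\}$. Let $F:\mathcal P_2(\mathbb R^d)\to\mathbb R$ be of class $\mathcal C^1$: there is a continuous function $\frac{\delta F}{\delta\mu}:\mathcal P_2(\mathbb R^d)\times\mathbb R^d\to\mathbb R$ (the flat derivative) and a constant $\kappa>0$ with $|\frac{\delta F}{\delta\mu}(\mu,x)|\le\kappa(1+|x|^2)$, $\int\frac{\delta F}{\delta\mu}(\mu,x)\,\mu(dx)=0$ and $$\lim_{\varepsilon\searrow0}\frac{F(\mu+\varepsilon(\mu'-\mu))-F(\mu)}{\varepsilon}=\int_{\mathbb R^d}\frac{\delta F}{\delta\mu}(\mu,x)\,(\mu'-\mu)(dx)$$ for all $\mu,\mu'\in\mathcal P_2(\mathbb R^d)$ and $x\in\mathbb R^d$. Assume that $x\mapsto\frac{\delta F}{\delta\mu}(\mu,x)$ is differentiable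 for every $\mu$, and write $\nabla_\mu F(\mu)(x)=\nabla_x\frac{\delta F}{\delta\mu}(\mu,x)$ for the Wasserstein gradient. Assume that $(\mu,x)\mapsto\nabla_\mu F(\mu)(x)$ is jointly continuous, that there is $C_F'>0$ with $|\nabla_\mu F(\mu)(x)|\le C_F'$ for all $\mu,x$, and that $L_F'>0$ satisfies $$|\nabla_\mu F(\mu')(x')-\nabla_\mu F(\mu)(x)|\le L_F'\big(|x'-x|+W_2(\mu',\mu)\big)$$ for all $\mu,\mu'\in\mathcal P_2(\mathbb R^d)$ and $x,x'\in\mathbb R^d$. Let $\pi(dx)\propto e^{-U(x)}dx$, where $U:\mathbb R^d\to\mathbb R$ is continuously differentiable with $\operatorname{ess\,inf}U>-\infty$ and $\liminf_{|x|\to\infty}U(x)/|x|^2>0$. Let $\sigma>0$, $0<\tau<1/L_F'$, $\mu^0\in\mathcal P_2^\lambda(\mathbb R^d)$ and $\nu^1=(I_d-\tau\nabla_\mu F(\mu^0))_\#\mu^0$. Then: 1. $\nu^1\in\mathcal P_2^\lambda(\mathbb R^d)$, and $I_d-\tau\nabla_\mu F(\mu^0)$ is the ($\mu^0$-a.e.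 unique) optimal transport map, for the quadratic cost, from $\mu^0$ to $\nu^1$; 2. there exists a unique minimizer $\mu^1\in\mathcal P_2^\lambda(\mathbb R^d)$ of $$\mathcal P_2^\lambda(\mathbb R^d)\ni\mu\mapsto\sigma\operatorname{KL}(\mu|\pi)+\frac1{2\tau}W_2^2(\mu,\nu^1)\in[0,\infty].$$ -/

import Mathlib

open MeasureTheory Filter Topology
open scoped ENNReal

noncomputable section

/-- The Euclidean space `ℝ^d`. -/
abbrev EucSp (d : ℕ) : Type := EuclideanSpace ℝ (Fin d)

/-- `𝒫₂(ℝ^d)`: Borel probability measures on `ℝ^d` with finite second moment. -/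
def P2 (d : ℕ) : Type :=
  {μ : Measure (EucSp d) // IsProbabilityMeasure μ ∧ ∫⁻ x, ‖x‖ₑ ^ 2 ∂μ < ∞}

/-- The underlying measure of an element of `𝒫₂(ℝ^d)`. -/
def P2.toMeasure {d : ℕ} (μ : P2 d) : Measure (EucSp d) := μ.1

/-- `𝒫₂^λ(ℝ^d)`: the elements of `𝒫₂(ℝ^d)` absolutely continuous with respect to Lebesgue measure. -/
def P2ac (d : ℕ) : Set (P2 d) := {μ | μ.toMeasure ≪ volume}

/-- `γ` is a coupling of `μ` and `ν`. -/
def IsCoupling {d : ℕ} (γ : Measure (EucSp d × EucSp d)) (μ ν : Measure (EucSp d)) : Prop :=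
  γ.map Prod.fst = μ ∧ γ.map Prod.snd = ν

/-- The quadratic transport cost `∫ |x - y|² γ(dx, dy)`. -/
def transportCost {d : ℕ} (γ : Measure (EucSp d × EucSp d)) : ℝ≥0∞ :=
  ∫⁻ p, ‖p.1 - p.2‖ₑ ^ 2 ∂γ

/-- The 2-Wasserstein distance, with values in `[0, ∞]`; it is finite on `𝒫₂(ℝ^d)`. -/
def W2 {d : ℕ} (μ ν : Measure (EucSp d)) : ℝ≥0∞ :=
  (⨅ γ : {γ : Measure (EucSp d × EucSp d) // IsCoupling γ μ ν}, transportCost γ.1) ^ (1 / 2 : ℝ)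

/-- The topology of `(𝒫₂(ℝ^d), W₂)`: a set is open when it contains, with each of its points,
a Wasserstein ball of positive radius centred there. -/
instance P2.instTopologicalSpace (d : ℕ) : TopologicalSpace (P2 d) where
  IsOpen s := ∀ μ ∈ s, ∃ ε : ℝ≥0∞, 0 < ε ∧ ∀ ν : P2 d, W2 μ.toMeasure ν.toMeasure < ε → ν ∈ s
  isOpen_univ := fun _ _ => ⟨1, one_pos, fun _ _ => Set.mem_univ _⟩
  isOpen_inter := by
    rintro s t hs ht μ ⟨h1, h2⟩
    obtain ⟨ε, hε, h⟩ := hs μ h1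
    obtain ⟨δ, hδ, h'⟩ := ht μ h2
    exact ⟨min ε δ, lt_min hε hδ, fun ν hν =>
      ⟨h ν (hν.trans_le (min_le_left _ _)), h' ν (hν.trans_le (min_le_right _ _))⟩⟩
  isOpen_sUnion := by
    rintro S hS μ ⟨s, hs, hμ⟩
    obtain ⟨ε, hε, h⟩ := hS s hs μ hμ
    exact ⟨ε, hε, fun ν hν => ⟨s, hs, h ν hν⟩⟩

/-- `γ` is an optimal coupling of `μ` and `ν`. -/
def IsOptimalCoupling {d : ℕ} (γ : Measure (EucSp d × EucSp d)) (μ ν : Measure (EucSp d)) : Prop :=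
  IsCoupling γ μ ν ∧ transportCost γ = W2 μ ν ^ 2

/-- `T` is an optimal transport map from `μ` to `ν`: it is Borel and `(I_d, T)_# μ` is an optimal
coupling of `μ` and `ν` (in particular `T_# μ = ν`). -/
def IsOptimalTransportMap {d : ℕ} (T : EucSp d → EucSp d) (μ ν : Measure (EucSp d)) : Prop :=
  Measurable T ∧ IsOptimalCoupling (μ.map fun x => (x, T x)) μ ν

/-- The mixture `μ + ε (μ' - μ) = (1 - ε) μ + ε μ'`, for `ε ∈ [0, 1]`. -/
def P2.mix {d : ℕ} (μ μ' : P2 d) (ε : unitInterval) : P2 d :=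
  ⟨ENNReal.ofReal (1 - ε) • μ.toMeasure + ENNReal.ofReal ε • μ'.toMeasure, by
    have h1 : IsProbabilityMeasure μ.toMeasure := μ.2.1
    have h2 : IsProbabilityMeasure μ'.toMeasure := μ'.2.1
    refine ⟨⟨?_⟩, ?_⟩
    · simp only [Measure.coe_add, Measure.coe_smul, Pi.add_apply, Pi.smul_apply, measure_univ,
        smul_eq_mul, mul_one]
      rw [← ENNReal.ofReal_add (sub_nonneg.2 ε.2.2) ε.2.1]
      simp
    · rw [lintegral_add_measure, lintegral_smul_measure, lintegral_smul_measure]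
      exact ENNReal.add_lt_top.2 ⟨ENNReal.mul_lt_top ENNReal.ofReal_lt_top μ.2.2,
        ENNReal.mul_lt_top ENNReal.ofReal_lt_top μ'.2.2⟩⟩

/-- `δF` is the flat derivative of `F`; that such a `δF` exists is the statement `F ∈ 𝒞¹`. -/
structure IsFlatDerivative {d : ℕ} (F : P2 d → ℝ) (δF : P2 d → EucSp d → ℝ) : Prop where
  continuous : Continuous fun p : P2 d × EucSp d => δF p.1 p.2
  growth : ∃ κ : ℝ, 0 < κ ∧ ∀ μ x, |δF μ x| ≤ κ * (1 + ‖x‖ ^ 2)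
  derivative : ∀ μ μ' : P2 d,
    Tendsto (fun ε : unitInterval => (F (μ.mix μ' ε) - F μ) / (ε : ℝ)) (𝓝[>] 0)
      (𝓝 (∫ x, δF μ x ∂μ'.toMeasure - ∫ x, δF μ x ∂μ.toMeasure))
  normalized : ∀ μ : P2 d, ∫ x, δF μ x ∂μ.toMeasure = 0

/-- The Wasserstein gradient `∇_μ F(μ)(x) = ∇ (δF/δμ)(μ, ·)(x)`, the Euclidean gradient of the flat
derivative. -/
def wassersteinGradient {d : ℕ} (δF : P2 d → EucSp d → ℝ) (μ : P2 d) (x : EucSp d) : EucSp d :=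
  gradient (δF μ) x

/-- The gradient descent map `I_d - τ ∇_μ F(μ)(·)`. -/
def gradientStep {d : ℕ} (δF : P2 d → EucSp d → ℝ) (τ : ℝ) (μ : P2 d) (x : EucSp d) : EucSp d :=
  x - τ • wassersteinGradient δF μ x

/-- The probability measure `π(dx) ∝ e^{-U(x)} dx`. -/
def gibbsMeasure {d : ℕ} (U : EucSp d → ℝ) : Measure (EucSp d) :=
  (volume : Measure (EucSp d)).tilted fun x => -U x

/-- The functional `μ ↦ σ KL(μ | π) + (1 / 2τ) W₂²(μ, ν)` of the JKO step. -/
def jkoFunctional {d : ℕ} (σ τ : ℝ) (π ν : Measure (EucSp d)) (μ : P2 d) : ℝ≥0∞ :=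
  ENNReal.ofReal σ * InformationTheory.klDiv μ.toMeasure π
    + ENNReal.ofReal (1 / (2 * τ)) * W2 μ.toMeasure ν ^ 2

end

/-! Claim 1 runs Brenier's theorem backwards. With `φ = δF μ₀`, the step `T = I - τ∇φ` is the
gradient of `ψ = |·|²/2 - τφ`. Since `∇φ` is `L`-Lipschitz and `τL < 1`, `ψ` is strongly convex with
modulus `1 - τL`, and `T` is a homeomorphism with Lipschitz inverse, so it preserves absolute
continuity. `ψ` and its Legendre transform give Kantorovich potentials whose contact set is exactly
the graph of `T`. There is no duality gap, so `T` is optimal, and any other optimal map must live on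
the same contact set (`gradient_descent_map`, `isOptimalTransportMap_of_potentials`).

Claim 2 is the direct method, with uniform convexity in place of weak compactness. Along linear
mixtures `W₂²` is convex, while KL gains a quarter of the squared Hellinger distance at the midpoint
(`klFun_midpoint_add_le`). Near-minimizers therefore have Hellinger-close densities
(`hellingerSq_le_of_le_iInf_add`). With zero defect this is uniqueness. Along a minimizing sequence
with summable rates it makes the densities Cauchy in `L¹(π)`, hence a.e. convergent to a probability
density. Fatou makes KL and the second moment lower semicontinuous. For `W₂²` one modifies
couplings: the mass common to the two densities keeps its transport plan, and the small remainder is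
coupled independently (`W2_sq_withDensity_le`). The measure `π` itself has finite energy, so the
infimum is finite. -/

section Transport

/-! ### Couplings and certificates of optimality by Kantorovich duality. -/

variable {d : ℕ}

instance (μ : P2 d) : IsProbabilityMeasure μ.toMeasure := μ.2.1

lemma W2_sq (μ ν : Measure (EucSp d)) :
    W2 μ ν ^ 2
      = ⨅ γ : {γ : Measure (EucSp d × EucSp d) // IsCoupling γ μ ν}, transportCost γ.1 := by
  rw [W2, ← ENNReal.rpow_natCast, ← ENNReal.rpow_mul]
  norm_num

lemma IsCoupling.W2_sq_le {μ ν : Measure (EucSp d)} {γ : Measure (EucSp d × EucSp d)}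
    (h : IsCoupling γ μ ν) : W2 μ ν ^ 2 ≤ transportCost γ := by
  rw [W2_sq]
  exact iInf_le (fun γ : {γ : Measure (EucSp d × EucSp d) // IsCoupling γ μ ν} =>
    transportCost γ.1) ⟨γ, h⟩

lemma isCoupling_map {T : EucSp d → EucSp d} (hT : Measurable T) (μ : Measure (EucSp d)) :
    IsCoupling (μ.map fun x => (x, T x)) μ (μ.map T) := by
  have h : Measurable fun x => (x, T x) := measurable_id.prodMk hT
  constructor
  · rw [Measure.map_map measurable_fst h]
    exact Measure.map_id
  · rw [Measure.map_map measurable_snd h]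
    rfl

lemma transportCost_map {T : EucSp d → EucSp d} (hT : Measurable T) (μ : Measure (EucSp d)) :
    transportCost (μ.map fun x => (x, T x)) = ∫⁻ x, ‖x - T x‖ₑ ^ 2 ∂μ := by
  exact lintegral_map (by fun_prop) (measurable_id.prodMk hT)

lemma W2_self (μ : Measure (EucSp d)) : W2 μ μ = 0 := by
  have h := (isCoupling_map measurable_id μ).W2_sq_le
  rw [transportCost_map measurable_id, Measure.map_id] at h
  simpa using h

lemma IsCoupling.integral_add {μ ν : Measure (EucSp d)} {γ : Measure (EucSp d × EucSp d)}
    (h : IsCoupling γ μ ν) {a b : EucSp d → ℝ} (ha : Integrable a μ) (hb : Integrable b ν) :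
    Integrable (fun p => a p.1 + b p.2) γ ∧
      ∫ p, (a p.1 + b p.2) ∂γ = ∫ x, a x ∂μ + ∫ y, b y ∂ν := by
  obtain ⟨rfl, rfl⟩ := h
  have h1 := ha.comp_measurable measurable_fst
  have h2 := hb.comp_measurable measurable_snd
  refine ⟨h1.add h2, ?_⟩
  rw [integral_map measurable_fst.aemeasurable ha.1, integral_map measurable_snd.aemeasurable hb.1]
  exact MeasureTheory.integral_add h1 h2

lemma ofReal_sq_norm (x : EucSp d) : ENNReal.ofReal (‖x‖ ^ 2) = ‖x‖ₑ ^ 2 := by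
  rw [ENNReal.ofReal_pow (norm_nonneg x), ofReal_norm]

lemma transportCost_eq_lintegral_ofReal (γ : Measure (EucSp d × EucSp d)) :
    transportCost γ = ∫⁻ p, ENNReal.ofReal (‖p.1 - p.2‖ ^ 2) ∂γ := by
  simp only [transportCost, ofReal_sq_norm]

lemma integrable_of_transportCost_ne_top {γ : Measure (EucSp d × EucSp d)}
    (hγ : transportCost γ ≠ ∞) :
    Integrable (fun p : EucSp d × EucSp d => ‖p.1 - p.2‖ ^ 2) γ := by
  rw [transportCost_eq_lintegral_ofReal] at hγ
  exact (lintegral_ofReal_ne_top_iff_integrable (by fun_prop)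
    (ae_of_all _ fun p => sq_nonneg _)).1 hγ

lemma transportCost_eq_ofReal_integral {γ : Measure (EucSp d × EucSp d)}
    (hγ : Integrable (fun p : EucSp d × EucSp d => ‖p.1 - p.2‖ ^ 2) γ) :
    transportCost γ = ENNReal.ofReal (∫ p, ‖p.1 - p.2‖ ^ 2 ∂γ) := by
  rw [transportCost_eq_lintegral_ofReal,
    ofReal_integral_eq_lintegral_ofReal hγ (ae_of_all _ fun p => sq_nonneg _)]

/-- Weak Kantorovich duality. -/
lemma IsCoupling.ofReal_le_transportCost {μ ν : Measure (EucSp d)}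
    {γ : Measure (EucSp d × EucSp d)} (h : IsCoupling γ μ ν) {a b : EucSp d → ℝ}
    (ha : Integrable a μ) (hb : Integrable b ν) (hle : ∀ x y, a x + b y ≤ ‖x - y‖ ^ 2) :
    ENNReal.ofReal (∫ x, a x ∂μ + ∫ y, b y ∂ν) ≤ transportCost γ := by
  by_cases hfin : transportCost γ = ∞
  · simp [hfin]
  · have hi := integrable_of_transportCost_ne_top hfin
    obtain ⟨hi', he'⟩ := h.integral_add ha hb
    rw [transportCost_eq_ofReal_integral hi, ← he']
    exact ENNReal.ofReal_le_ofReal (integral_mono hi' hi fun p => hle p.1 p.2)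

/-- A coupling without duality gap is concentrated on the contact set. -/
lemma IsCoupling.ae_contact {μ ν : Measure (EucSp d)}
    {γ : Measure (EucSp d × EucSp d)} (h : IsCoupling γ μ ν) {a b : EucSp d → ℝ}
    (ha : Integrable a μ) (hb : Integrable b ν) (hle : ∀ x y, a x + b y ≤ ‖x - y‖ ^ 2)
    (h0 : 0 ≤ ∫ x, a x ∂μ + ∫ y, b y ∂ν)
    (hγ : transportCost γ = ENNReal.ofReal (∫ x, a x ∂μ + ∫ y, b y ∂ν)) :
    ∀ᵐ p ∂γ, a p.1 + b p.2 = ‖p.1 - p.2‖ ^ 2 := by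
  have hi := integrable_of_transportCost_ne_top (hγ.trans_ne ENNReal.ofReal_ne_top)
  obtain ⟨hi', he'⟩ := h.integral_add ha hb
  rw [transportCost_eq_ofReal_integral hi, ← he', ENNReal.ofReal_eq_ofReal_iff
    (integral_nonneg fun p => sq_nonneg _) (h0.trans_eq he'.symm)] at hγ
  have hz : ∫ p, (‖p.1 - p.2‖ ^ 2 - (a p.1 + b p.2)) ∂γ = 0 := by
    rw [integral_sub hi hi', hγ, sub_self]
  have hd : Integrable (fun p => ‖p.1 - p.2‖ ^ 2 - (a p.1 + b p.2)) γ := hi.sub hi'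
  have hnn : ∀ p : EucSp d × EucSp d, 0 ≤ ‖p.1 - p.2‖ ^ 2 - (a p.1 + b p.2) :=
    fun p => sub_nonneg.2 (hle p.1 p.2)
  rw [integral_eq_zero_iff_of_nonneg hnn hd] at hz
  exact hz.mono fun p hp => (sub_eq_zero.1 hp).symm

/-- Kantorovich potentials whose contact set is the graph of `T` certify that `T` is the unique
optimal map. -/
lemma isOptimalTransportMap_of_potentials {μ : Measure (EucSp d)} {T : EucSp d → EucSp d}
    (hT : Measurable T) {a b : EucSp d → ℝ} (ha : Integrable a μ) (hb : Integrable b (μ.map T))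
    (hle : ∀ x y, a x + b y ≤ ‖x - y‖ ^ 2) (heq : ∀ x, a x + b (T x) = ‖x - T x‖ ^ 2)
    (huniq : ∀ x y, a x + b y = ‖x - y‖ ^ 2 → y = T x) :
    IsOptimalTransportMap T μ (μ.map T) ∧
      ∀ T' : EucSp d → EucSp d, IsOptimalTransportMap T' μ (μ.map T) → T' =ᵐ[μ] T := by
  have hbT : Integrable (fun x => b (T x)) μ := hb.comp_measurable hT
  have hdual : ∫ x, a x ∂μ + ∫ y, b y ∂(μ.map T) = ∫ x, ‖x - T x‖ ^ 2 ∂μ := by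
    rw [integral_map hT.aemeasurable hb.1, ← integral_add ha hbT]
    simp only [heq]
  have hcT : transportCost (μ.map fun x => (x, T x))
      = ENNReal.ofReal (∫ x, a x ∂μ + ∫ y, b y ∂(μ.map T)) := by
    rw [transportCost_map hT, hdual, ofReal_integral_eq_lintegral_ofReal
      ((ha.add hbT).congr (ae_of_all _ heq)) (ae_of_all _ fun x => sq_nonneg _)]
    simp only [ofReal_sq_norm]
  have hW : W2 μ (μ.map T) ^ 2 = ENNReal.ofReal (∫ x, a x ∂μ + ∫ y, b y ∂(μ.map T)) := by
    refine le_antisymm ?_ ?_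
    · rw [← hcT]
      exact (isCoupling_map hT μ).W2_sq_le
    · rw [W2_sq]
      exact le_iInf fun γ => γ.2.ofReal_le_transportCost ha hb hle
  refine ⟨⟨hT, isCoupling_map hT μ, hcT.trans hW.symm⟩, fun T' hT' => ?_⟩
  obtain ⟨hTm', hcpl, hcost⟩ := hT'
  have h0 : 0 ≤ ∫ x, a x ∂μ + ∫ y, b y ∂(μ.map T) := by
    rw [hdual]
    exact integral_nonneg fun x => sq_nonneg _
  have hae : ∀ᵐ x ∂μ, a x + b (T' x) = ‖x - T' x‖ ^ 2 :=
    ae_of_ae_map (measurable_id.prodMk hTm').aemeasurable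
      (hcpl.ae_contact ha hb hle h0 (hcost.trans hW))
  filter_upwards [hae] with x hx
  exact huniq _ _ hx

end Transport

/-! ### The gradient step as an optimal transport map. -/

section GradientStep

variable {d : ℕ}

open scoped RealInnerProductSpace Gradient

/-- The descent lemma. -/
lemma sub_le_of_lipschitz_gradient {φ : EucSp d → ℝ} (hφ : Differentiable ℝ φ) {L : ℝ}
    (hL : ∀ x x', ‖∇ φ x' - ∇ φ x‖ ≤ L * ‖x' - x‖) (x y : EucSp d) :
    φ y - φ x - ⟪∇ φ x, y - x⟫ ≤ L / 2 * ‖y - x‖ ^ 2 := by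
  set v := y - x with hv
  -- The claim is `g 1 ≤ g 0`; the Lipschitz bound on `∇ φ` makes `g' ≤ 0` on `(0, 1)`.
  let g : ℝ → ℝ := fun t => φ (x + t • v) - t * ⟪∇ φ x, v⟫ - L / 2 * t ^ 2 * ‖v‖ ^ 2
  have hg : ∀ t, HasDerivAt g (⟪∇ φ (x + t • v) - ∇ φ x, v⟫ - L * t * ‖v‖ ^ 2) t := by
    intro t
    have h1 : HasDerivAt (fun t : ℝ => x + t • v) v t := by
      simpa using ((hasDerivAt_id t).smul_const v).const_add x
    have h2 := (hφ (x + t • v)).hasGradientAt.hasFDerivAt.comp_hasDerivAt t h1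
    have h3 := (h2.sub ((hasDerivAt_id t).mul_const ⟪∇ φ x, v⟫)).sub
      ((((hasDerivAt_id t).pow 2).const_mul (L / 2)).mul_const (‖v‖ ^ 2))
    refine HasDerivAt.congr_deriv (f := g) h3 ?_
    rw [InnerProductSpace.toDual_apply_apply, inner_sub_left]
    simp only [id_eq, Nat.cast_ofNat, Nat.add_one_sub_one, pow_one]
    ring
  have hanti : AntitoneOn g (Set.Icc 0 1) := by
    refine antitoneOn_of_deriv_nonpos (convex_Icc 0 1)
      (fun t _ => (hg t).continuousAt.continuousWithinAt)
      (fun t _ => (hg t).differentiableAt.differentiableWithinAt) fun t ht => ?_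
    rw [interior_Icc] at ht
    rw [(hg t).deriv, sub_nonpos]
    refine (real_inner_le_norm _ _).trans ?_
    have := hL x (x + t • v)
    rw [add_sub_cancel_left, norm_smul, Real.norm_of_nonneg ht.1.le] at this
    nlinarith [norm_nonneg v]
  have := hanti (Set.left_mem_Icc.2 zero_le_one) (Set.right_mem_Icc.2 zero_le_one) zero_le_one
  simp only [g, hv, zero_smul, one_smul, add_sub_cancel, add_zero, one_mul, zero_mul] at this
  linarith

/-- Preimages under an antilipschitz map enlarge `d`-dimensional Hausdorff measure by at most a
constant factor, and that measure has the same null sets as Lebesgue measure. No differentiability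
of `T` is needed. -/
lemma absolutelyContinuous_map_of_antilipschitz {T : EucSp d → EucSp d} (hT : Measurable T)
    {K : NNReal} (hK : AntilipschitzWith K T) {μ : Measure (EucSp d)} (hμ : μ ≪ volume) :
    μ.map T ≪ volume := by
  refine Measure.AbsolutelyContinuous.mk fun s hs h0 => ?_
  rw [Measure.map_apply hT hs]
  apply hμ
  have h1 : (μH[Module.finrank ℝ (EucSp d)] : Measure (EucSp d)) s = 0 :=
    Measure.absolutelyContinuous_isAddHaarMeasure _ volume h0
  have h2 : (μH[Module.finrank ℝ (EucSp d)] : Measure (EucSp d)) (T ⁻¹' s) = 0 := by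
    have := hK.hausdorffMeasure_preimage_le (Nat.cast_nonneg (Module.finrank ℝ (EucSp d))) s
    rw [h1, mul_zero] at this
    exact le_antisymm this bot_le
  exact Measure.absolutelyContinuous_isAddHaarMeasure volume
    (μH[Module.finrank ℝ (EucSp d)] : Measure (EucSp d)) h2

lemma approximatesLinearOn_id_sub_smul {G : EucSp d → EucSp d} {L : ℝ}
    (hL : ∀ x x', ‖G x' - G x‖ ≤ L * ‖x' - x‖) {τ : ℝ} (hτ : 0 ≤ τ) {c : NNReal}
    (hc : τ * L = c) :
    ApproximatesLinearOn (fun x => x - τ • G x)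
      (ContinuousLinearEquiv.refl ℝ (EucSp d) : EucSp d →L[ℝ] EucSp d) Set.univ c := by
  intro x _ y _
  have : x - τ • G x - (y - τ • G y)
      - (ContinuousLinearEquiv.refl ℝ (EucSp d) : EucSp d →L[ℝ] EucSp d) (x - y)
      = -(τ • (G x - G y)) := by
    simp [smul_sub]
    abel
  rw [this, norm_neg, norm_smul, Real.norm_of_nonneg hτ, ← hc, mul_assoc]
  exact mul_le_mul_of_nonneg_left (hL y x) hτ

lemma lintegral_enorm_sq_lt_top_iff {μ : Measure (EucSp d)} :
    ∫⁻ x, ‖x‖ₑ ^ 2 ∂μ < ∞ ↔ Integrable (fun x : EucSp d => ‖x‖ ^ 2) μ := by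
  rw [lt_top_iff_ne_top, ← lintegral_ofReal_ne_top_iff_integrable (by fun_prop)
    (ae_of_all _ fun p => sq_nonneg _)]
  simp only [ofReal_sq_norm]

lemma integrable_of_quadratic_growth {μ : Measure (EucSp d)} [IsFiniteMeasure μ]
    (hμ : ∫⁻ x, ‖x‖ₑ ^ 2 ∂μ < ∞) {f : EucSp d → ℝ} (hf : Measurable f) {κ : ℝ}
    (h : ∀ x, |f x| ≤ κ * (1 + ‖x‖ ^ 2)) : Integrable f μ :=
  (((integrable_const 1).add (lintegral_enorm_sq_lt_top_iff.1 hμ)).const_mul κ).mono'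
    hf.aestronglyMeasurable (ae_of_all _ h)

/-- A gradient step of length `τ < 1 / L` along a quadratically growing `φ` with `L`-Lipschitz
gradient. -/
theorem gradient_descent_map {φ : EucSp d → ℝ} (hφ : Differentiable ℝ φ) {L : ℝ} (hL0 : 0 < L)
    (hL : ∀ x x', ‖∇ φ x' - ∇ φ x‖ ≤ L * ‖x' - x‖) {κ : ℝ}
    (hκ : ∀ x, |φ x| ≤ κ * (1 + ‖x‖ ^ 2)) {C : ℝ} (hC : ∀ x, ‖∇ φ x‖ ≤ C)
    {τ : ℝ} (hτ : 0 < τ) (hτL : τ < 1 / L)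
    {μ : Measure (EucSp d)} [IsProbabilityMeasure μ] (hμ2 : ∫⁻ x, ‖x‖ₑ ^ 2 ∂μ < ∞)
    (hμ : μ ≪ volume) {T : EucSp d → EucSp d} (hT : T = fun x => x - τ • ∇ φ x) :
    IsProbabilityMeasure (μ.map T) ∧ ∫⁻ x, ‖x‖ₑ ^ 2 ∂(μ.map T) < ∞ ∧ μ.map T ≪ volume ∧
      IsOptimalTransportMap T μ (μ.map T) ∧
      ∀ T' : EucSp d → EucSp d, IsOptimalTransportMap T' μ (μ.map T) → T' =ᵐ[μ] T := by
  have hτL1 : τ * L < 1 := by rwa [lt_div_iff₀ hL0] at hτL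
  have hA : ApproximatesLinearOn T
      (ContinuousLinearEquiv.refl ℝ (EucSp d) : EucSp d →L[ℝ] EucSp d) Set.univ
      (τ * L).toNNReal := hT ▸ approximatesLinearOn_id_sub_smul hL hτ.le
      (Real.coe_toNNReal _ (by positivity)).symm
  -- The first alternative is `d = 0`, where the identity has norm `0` rather than `1`.
  have hc : Subsingleton (EucSp d) ∨ (τ * L).toNNReal <
      ‖((ContinuousLinearEquiv.refl ℝ (EucSp d)).symm : EucSp d →L[ℝ] EucSp d)‖₊⁻¹ := by
    rcases subsingleton_or_nontrivial (EucSp d) with h | h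
    · exact Or.inl h
    · right
      have : ‖((ContinuousLinearEquiv.refl ℝ (EucSp d)).symm : EucSp d →L[ℝ] EucSp d)‖₊ = 1 :=
        ContinuousLinearMap.nnnorm_id
      rw [this, inv_one]
      exact Real.toNNReal_lt_one.2 hτL1
  let e : EucSp d ≃ₜ EucSp d := hA.toHomeomorph T hc
  have he : ∀ x, e x = T x := fun x => rfl
  have hTm : Measurable T := e.continuous.measurable
  have hac : μ.map T ≪ volume := by
    have h := hA.antilipschitz hc
    obtain ⟨K, hK⟩ : ∃ K, AntilipschitzWith K T :=
      ⟨_, fun x y => h ⟨x, trivial⟩ ⟨y, trivial⟩⟩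
    exact absolutelyContinuous_map_of_antilipschitz hTm hK hμ
  have hTn : ∀ x, ‖T x‖ ^ 2 ≤ 2 * (1 + (τ * C) ^ 2) * (1 + ‖x‖ ^ 2) := by
    intro x
    have h1 : ‖T x‖ ≤ ‖x‖ + τ * C := by
      rw [hT]
      refine (norm_sub_le _ _).trans ?_
      rw [norm_smul, Real.norm_of_nonneg hτ.le]
      gcongr
      exact hC x
    nlinarith [norm_nonneg (T x), norm_nonneg x, sq_nonneg (‖x‖ - τ * C),
      mul_nonneg (sq_nonneg (τ * C)) (sq_nonneg ‖x‖)]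
  have h2T : Integrable (fun x => ‖T x‖ ^ 2) μ :=
    integrable_of_quadratic_growth hμ2 (by fun_prop) fun x => by
      rw [abs_of_nonneg (by positivity)]; exact hTn x
  have h2 : ∫⁻ x, ‖x‖ₑ ^ 2 ∂(μ.map T) < ∞ := by
    rw [lintegral_enorm_sq_lt_top_iff,
      integrable_map_measure (by fun_prop) hTm.aemeasurable]
    exact h2T
  have hprob : IsProbabilityMeasure (μ.map T) :=
    Measure.isProbabilityMeasure_map hTm.aemeasurable
  have hφm : Measurable φ := hφ.continuous.measurable
  have hφi : Integrable φ μ := integrable_of_quadratic_growth hμ2 hφm hκ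
  -- Brenier potential: `∇ψ = T`. The inequality `hψ` is its strong convexity.
  let ψ : EucSp d → ℝ := fun x => ‖x‖ ^ 2 / 2 - τ * φ x
  have hψm : Measurable ψ := by fun_prop
  have hsm : Measurable e.symm := e.symm.continuous.measurable
  have hψi : Integrable ψ μ :=
    ((lintegral_enorm_sq_lt_top_iff.1 hμ2).div_const 2).sub (hφi.const_mul τ)
  have hψ : ∀ x z, (1 - τ * L) / 2 * ‖x - z‖ ^ 2 ≤ ψ x - ψ z - ⟪T z, x - z⟫ := by
    intro x z
    have h1 := sub_le_of_lipschitz_gradient hφ hL z x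
    have h3 : ‖x‖ ^ 2 = ‖x - z‖ ^ 2 + 2 * ⟪z, x - z⟫ + ‖z‖ ^ 2 := by
      have := norm_add_sq_real (x - z) z
      rw [sub_add_cancel, real_inner_comm] at this
      exact this
    have h4 : ⟪T z, x - z⟫ = ⟪z, x - z⟫ - τ * ⟪∇ φ z, x - z⟫ := by
      rw [hT]
      simp only [inner_sub_left, inner_smul_left]
      simp
    simp only [ψ]
    nlinarith
  have hxy : ∀ x y : EucSp d, ‖x - y‖ ^ 2 = ‖x‖ ^ 2 + ‖y‖ ^ 2 - 2 * ⟪y, x⟫ := by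
    intro x y
    rw [norm_sub_sq_real, real_inner_comm]
    ring
  let a : EucSp d → ℝ := fun x => ‖x‖ ^ 2 - 2 * ψ x
  -- The bracket is the Legendre transform of `ψ` at `y`, whose supremum is attained where `T x =
  -- y`, that is at `x = e.symm y`.
  let b : EucSp d → ℝ := fun y => ‖y‖ ^ 2 - 2 * (⟪y, e.symm y⟫ - ψ (e.symm y))
  have hgap : ∀ x y, (1 - τ * L) * ‖x - e.symm y‖ ^ 2 ≤ ‖x - y‖ ^ 2 - (a x + b y) := by
    intro x y
    have h := hψ x (e.symm y)
    rw [← he, e.apply_symm_apply, inner_sub_right] at h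
    rw [hxy x y]
    simp only [a, b]
    linarith
  have heq : ∀ x, a x + b (T x) = ‖x - T x‖ ^ 2 := by
    intro x
    simp only [a, b, hxy]
    rw [← he, e.symm_apply_apply]
    ring
  have hbm : Measurable b := by fun_prop
  refine ⟨hprob, h2, hac, isOptimalTransportMap_of_potentials hTm (a := a) (b := b)
    ((lintegral_enorm_sq_lt_top_iff.1 hμ2).sub (hψi.const_mul 2)) ?_ ?_ heq ?_⟩
  -- Integrability of `b ∘ T` is read off from `b (T x) = ‖x - T x‖² - a x`, which avoids any growth
  -- estimate for the inverse of `T`.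
  · rw [integrable_map_measure hbm.aestronglyMeasurable hTm.aemeasurable]
    have hd : Integrable (fun x => ‖x - T x‖ ^ 2) μ := by
      refine integrable_of_quadratic_growth hμ2 (κ := (τ * C) ^ 2) (by fun_prop) fun x => ?_
      rw [abs_of_nonneg (by positivity), hT]
      simp only [sub_sub_cancel, norm_smul, Real.norm_of_nonneg hτ.le]
      have h1 : (τ * ‖∇ φ x‖) ^ 2 ≤ (τ * C) ^ 2 := by
        gcongr
        exact hC x
      nlinarith [mul_nonneg (sq_nonneg (τ * C)) (sq_nonneg ‖x‖)]
    have ha : Integrable a μ := (lintegral_enorm_sq_lt_top_iff.1 hμ2).sub (hψi.const_mul 2)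
    refine (hd.sub ha).congr (ae_of_all _ fun x => ?_)
    simp only [Pi.sub_apply, Function.comp, ← heq x]
    ring
  · intro x y
    have := hgap x y
    nlinarith [mul_nonneg (sub_nonneg.2 hτL1.le) (sq_nonneg ‖x - e.symm y‖)]
  · intro x y hxy'
    have h := hgap x y
    rw [hxy', sub_self] at h
    have h0 : ‖x - e.symm y‖ ^ 2 = 0 := by
      have : 0 < 1 - τ * L := by linarith
      nlinarith [sq_nonneg ‖x - e.symm y‖]
    have h1 : x = e.symm y := by
      rw [sq_eq_zero_iff, norm_eq_zero, sub_eq_zero] at h0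
      exact h0
    rw [h1, ← he, e.apply_symm_apply]

end GradientStep

/-! ### Convexity and lower semicontinuity of the squared Wasserstein distance. -/

section Wasserstein

variable {d : ℕ}

/-- Reduces a bound by `W₂²` to arbitrary couplings, so that no optimal coupling has to exist. -/
lemma le_mul_W2_sq_add {μ ν : Measure (EucSp d)} {A B k : ℝ≥0∞} (hk0 : k ≠ 0) (hk : k ≠ ∞)
    (h : ∀ γ, IsCoupling γ μ ν → A ≤ k * transportCost γ + B) : A ≤ k * W2 μ ν ^ 2 + B := by
  rw [W2_sq, ENNReal.mul_iInf_of_ne hk0 hk, ENNReal.iInf_add]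
  exact le_iInf fun γ => h γ.1 γ.2

lemma enorm_sub_sq_le (x y : EucSp d) : ‖x - y‖ₑ ^ 2 ≤ 2 * ‖x‖ₑ ^ 2 + 2 * ‖y‖ₑ ^ 2 := by
  have h2 : ∀ a : ℝ, 2 * ENNReal.ofReal a = ENNReal.ofReal (2 * a) := fun a => by
    rw [ENNReal.ofReal_mul zero_le_two, ENNReal.ofReal_ofNat]
  rw [← ofReal_sq_norm, ← ofReal_sq_norm, ← ofReal_sq_norm, h2, h2,
    ← ENNReal.ofReal_add (by positivity) (by positivity)]
  refine ENNReal.ofReal_le_ofReal ?_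
  nlinarith [norm_sub_le x y, norm_nonneg (x - y), norm_nonneg x, norm_nonneg y,
    sq_nonneg (‖x‖ - ‖y‖)]

lemma transportCost_add (γ γ' : Measure (EucSp d × EucSp d)) :
    transportCost (γ + γ') = transportCost γ + transportCost γ' :=
  lintegral_add_measure _ _ _

lemma transportCost_smul (c : ℝ≥0∞) (γ : Measure (EucSp d × EucSp d)) :
    transportCost (c • γ) = c * transportCost γ :=
  lintegral_smul_measure _ _

lemma transportCost_le_moments (γ : Measure (EucSp d × EucSp d)) :
    transportCost γ ≤ 2 * ∫⁻ x, ‖x‖ₑ ^ 2 ∂(γ.map Prod.fst)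
      + 2 * ∫⁻ y, ‖y‖ₑ ^ 2 ∂(γ.map Prod.snd) := by
  rw [lintegral_map (by fun_prop) measurable_fst, lintegral_map (by fun_prop) measurable_snd,
    ← lintegral_const_mul _ (by fun_prop), ← lintegral_const_mul _ (by fun_prop),
    ← lintegral_add_left (by fun_prop)]
  exact lintegral_mono fun p => enorm_sub_sq_le p.1 p.2

lemma IsCoupling.smul_add_smul {μ μ' ν : Measure (EucSp d)}
    {γ γ' : Measure (EucSp d × EucSp d)} (h : IsCoupling γ μ ν) (h' : IsCoupling γ' μ' ν)
    {s t : ℝ≥0∞} (hst : s + t = 1) : IsCoupling (s • γ + t • γ') (s • μ + t • μ') ν := by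
  constructor
  · rw [Measure.map_add _ _ measurable_fst, Measure.map_smul, Measure.map_smul, h.1, h'.1]
  · rw [Measure.map_add _ _ measurable_snd, Measure.map_smul, Measure.map_smul, h.2, h'.2,
      ← add_smul, hst, one_smul]

/-- The average of a coupling of `μ, ν` and one of `μ', ν` couples the midpoint with `ν`, and the
cost is linear in the coupling. -/
lemma W2_sq_midpoint_le (μ μ' ν : Measure (EucSp d)) :
    W2 ((2⁻¹ : ℝ≥0∞) • μ + (2⁻¹ : ℝ≥0∞) • μ') ν ^ 2
      ≤ 2⁻¹ * W2 μ ν ^ 2 + 2⁻¹ * W2 μ' ν ^ 2 := by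
  refine le_mul_W2_sq_add (by simp) (by simp) fun γ hγ => ?_
  rw [add_comm (2⁻¹ * transportCost γ)]
  refine le_mul_W2_sq_add (by simp) (by simp) fun γ' hγ' => ?_
  rw [add_comm (2⁻¹ * transportCost γ'), ← transportCost_smul, ← transportCost_smul, ← transportCost_add]
  exact (hγ.smul_add_smul hγ' ENNReal.inv_two_add_inv_two).W2_sq_le

lemma second_moment_le (μ ν : Measure (EucSp d)) :
    ∫⁻ x, ‖x‖ₑ ^ 2 ∂μ ≤ 2 * W2 μ ν ^ 2 + 2 * ∫⁻ y, ‖y‖ₑ ^ 2 ∂ν := by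
  refine le_mul_W2_sq_add (by simp) (by simp) ?_
  rintro γ ⟨rfl, rfl⟩
  rw [lintegral_map (by fun_prop) measurable_fst, lintegral_map (by fun_prop) measurable_snd,
    transportCost, ← lintegral_const_mul _ (by fun_prop), ← lintegral_const_mul _ (by fun_prop),
    ← lintegral_add_left (by fun_prop)]
  refine lintegral_mono fun p => ?_
  have h := enorm_sub_sq_le (p.1 - p.2) (-p.2)
  rwa [sub_neg_eq_add, sub_add_cancel, enorm_neg] at h

lemma W2_sq_lt_top {μ ν : Measure (EucSp d)} [IsProbabilityMeasure μ] [IsProbabilityMeasure ν]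
    (hμ : ∫⁻ x, ‖x‖ₑ ^ 2 ∂μ < ∞) (hν : ∫⁻ x, ‖x‖ₑ ^ 2 ∂ν < ∞) : W2 μ ν ^ 2 < ∞ := by
  have h : IsCoupling (μ.prod ν) μ ν := by
    constructor
    · rw [Measure.map_fst_prod, measure_univ, one_smul]
    · rw [Measure.map_snd_prod, measure_univ, one_smul]
  refine (h.W2_sq_le.trans (transportCost_le_moments _)).trans_lt ?_
  rw [h.1, h.2]
  exact ENNReal.add_lt_top.2 ⟨ENNReal.mul_lt_top (by simp) hμ, ENNReal.mul_lt_top (by simp) hν⟩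

/-- Thinning a coupling by a weight `w` of the first variable, and completing by the independent
coupling of the missing marginals. -/
lemma IsCoupling.W2_sq_le_thinning {μ' ν ρ : Measure (EucSp d)} [IsProbabilityMeasure ν]
    [IsFiniteMeasure ρ] {γ : Measure (EucSp d × EucSp d)} (h : IsCoupling γ μ' ν)
    {w : EucSp d → ℝ≥0∞} (hw : Measurable w) (hw1 : ∀ x, w x ≤ 1)
    (hmass : (μ'.withDensity w + ρ) Set.univ = 1) :
    W2 (μ'.withDensity w + ρ) ν ^ 2 ≤ transportCost γ + 2 * ∫⁻ x, ‖x‖ₑ ^ 2 ∂ρ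
      + 2 * ∫⁻ p, ‖p.2‖ₑ ^ 2 * (1 - w p.1) ∂γ := by
  have hwf : Measurable fun p : EucSp d × EucSp d => w p.1 := hw.comp measurable_fst
  have hwf' : Measurable fun p : EucSp d × EucSp d => 1 - w p.1 := hwf.const_sub 1
  -- `γ₁` is the part of the plan that is kept, `γ₂` the part that is discarded; the second marginal
  -- of `γ₂` has to be supplied again, from `ρ`.
  set γ₁ := γ.withDensity fun p => w p.1
  set γ₂ := γ.withDensity fun p => 1 - w p.1
  have hsum : γ₁ + γ₂ = γ := by
    rw [← withDensity_add_left hwf]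
    have : ((fun p : EucSp d × EucSp d => w p.1) + fun p => 1 - w p.1) = 1 := by
      ext p
      exact add_tsub_cancel_of_le (hw1 p.1)
    rw [this, withDensity_one]
  have hγ1 : γ Set.univ = 1 := by
    rw [← measure_univ (μ := ν), ← h.2, Measure.map_apply measurable_snd MeasurableSet.univ,
      Set.preimage_univ]
  have hfin : IsFiniteMeasure γ := ⟨by simp [hγ1]⟩
  have hfin₁ : IsFiniteMeasure γ₁ := isFiniteMeasure_of_le γ (hsum ▸ Measure.le_add_right le_rfl)
  have hfin₂ : IsFiniteMeasure γ₂ := isFiniteMeasure_of_le γ (hsum ▸ Measure.le_add_left le_rfl)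
  have hfst : γ₁.map Prod.fst = μ'.withDensity w := by
    ext s hs
    rw [Measure.map_apply measurable_fst hs, withDensity_apply _ (measurable_fst hs),
      withDensity_apply _ hs, ← h.1, setLIntegral_map hs hw measurable_fst]
  have hmass₂ : γ₂ Set.univ = ρ Set.univ := by
    have h1 : γ₁ Set.univ + γ₂ Set.univ = 1 := by rw [← Measure.add_apply, hsum, hγ1]
    have h2 : γ₁ Set.univ = μ'.withDensity w Set.univ := by
      rw [← hfst, Measure.map_apply measurable_fst MeasurableSet.univ, Set.preimage_univ]
    rw [Measure.add_apply, ← h2, ← h1] at hmass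
    exact ((ENNReal.add_right_inj (measure_ne_top γ₁ _)).1 hmass).symm
  set κ := γ₂.map Prod.snd
  have hκ : κ Set.univ = ρ Set.univ := by
    rw [Measure.map_apply measurable_snd MeasurableSet.univ, Set.preimage_univ, hmass₂]
  -- Both factors have the same mass, so one normalization gives both marginals. If `ρ = 0`, the
  -- inverse is `∞` but multiplies the zero measure.
  set η := (ρ Set.univ)⁻¹ • ρ.prod κ
  have hη : η.map Prod.fst = ρ ∧ η.map Prod.snd = κ := by
    rw [Measure.map_smul, Measure.map_smul, Measure.map_fst_prod, Measure.map_snd_prod, hκ,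
      smul_smul, smul_smul]
    by_cases h0 : ρ Set.univ = 0
    · rw [h0] at hκ
      rw [Measure.measure_univ_eq_zero] at h0 hκ
      rw [h0, hκ, smul_zero]
      exact ⟨rfl, rfl⟩
    · rw [ENNReal.inv_mul_cancel h0 (measure_ne_top ρ _), one_smul, one_smul]
      exact ⟨rfl, rfl⟩
  have hc : IsCoupling (γ₁ + η) (μ'.withDensity w + ρ) ν := by
    constructor
    · rw [Measure.map_add _ _ measurable_fst, hfst, hη.1]
    · rw [Measure.map_add _ _ measurable_snd, hη.2, ← Measure.map_add _ _ measurable_snd, hsum,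
        h.2]
  refine hc.W2_sq_le.trans ?_
  rw [transportCost_add, add_assoc]
  refine add_le_add ?_ ?_
  · exact lintegral_mono' (hsum ▸ Measure.le_add_right le_rfl) le_rfl
  · refine (transportCost_le_moments η).trans ?_
    rw [hη.1, hη.2, lintegral_map (by fun_prop) measurable_snd,
      lintegral_withDensity_eq_lintegral_mul _ hwf' (by fun_prop)]
    simp only [Pi.mul_apply, mul_comm]
    exact le_rfl

/-- Replacing the density `g` by `f` changes the squared Wasserstein distance by a moment of the
excess `f - min f g` and a tail of the target. -/
lemma W2_sq_withDensity_le {π ν : Measure (EucSp d)} [IsProbabilityMeasure ν]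
    {f g : EucSp d → ℝ≥0∞} (hf : Measurable f) (hg : Measurable g)
    (hf1 : ∫⁻ x, f x ∂π = 1) (hg1 : ∫⁻ x, g x ∂π = 1) (R : ℝ≥0∞) :
    W2 (π.withDensity f) ν ^ 2 ≤ W2 (π.withDensity g) ν ^ 2
      + (2 * ∫⁻ x, ‖x‖ₑ ^ 2 * (f x - min (f x) (g x)) ∂π
        + 2 * (R ^ 2 * ∫⁻ x, (f x - min (f x) (g x)) ∂π
          + ∫⁻ y in {y | R < ‖y‖ₑ}, ‖y‖ₑ ^ 2 ∂ν)) := by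
  rw [← one_mul (W2 (π.withDensity g) ν ^ 2)]
  refine le_mul_W2_sq_add one_ne_zero ENNReal.one_ne_top fun γ hγ => ?_
  rw [one_mul, ← add_assoc]
  -- The fraction of the `g`-mass at `x` that `f` can reuse; where `g x = 0` it is `0 / 0 = 0`.
  let w : EucSp d → ℝ≥0∞ := fun x => min (f x) (g x) / g x
  have hw : Measurable w := (hf.min hg).div hg
  have hw1 : ∀ x, w x ≤ 1 := fun x => ENNReal.div_le_of_le_mul (by simp)
  have hgw : g * w =ᵐ[π] fun x => min (f x) (g x) := by
    filter_upwards [ae_lt_top hg (by simp [hg1])] with x hx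
    by_cases h0 : g x = 0
    · simp [h0]
    · exact ENNReal.mul_div_cancel h0 hx.ne
  have hμw : (π.withDensity g).withDensity w = π.withDensity fun x => min (f x) (g x) := by
    rw [← withDensity_mul _ hg hw, withDensity_congr_ae hgw]
  have hfe : Measurable fun x => f x - min (f x) (g x) := hf.sub (hf.min hg)
  have hsplit : (π.withDensity g).withDensity w
      + π.withDensity (fun x => f x - min (f x) (g x)) = π.withDensity f := by
    rw [hμw, ← withDensity_add_left (hf.min hg)]
    congr 1
    ext x
    exact add_tsub_cancel_of_le (min_le_left _ _)
  have hexc : ∫⁻ x, (f x - min (f x) (g x)) ∂π ≠ ∞ := by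
    refine ne_top_of_le_ne_top ENNReal.one_ne_top ?_
    rw [← hf1]
    exact lintegral_mono fun x => tsub_le_self
  have hρ : IsFiniteMeasure (π.withDensity fun x => f x - min (f x) (g x)) :=
    isFiniteMeasure_withDensity hexc
  have huniv : π.withDensity f Set.univ = 1 := by
    rw [withDensity_apply _ MeasurableSet.univ, Measure.restrict_univ, hf1]
  have hmain := hγ.W2_sq_le_thinning hw hw1 (by rw [hsplit, huniv])
  rw [hsplit, lintegral_withDensity_eq_lintegral_mul _ hfe (by fun_prop)] at hmain
  refine hmain.trans ?_
  -- The discarded mass is `∫ (g - min f g)`, which equals `∫ (f - min f g)` because `f` and `g`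
  -- both have mass one.
  have hdef : ∫⁻ p, (1 - w p.1) ∂γ ≤ ∫⁻ x, (f x - min (f x) (g x)) ∂π := by
    have h1 : ∫⁻ p, (1 - w p.1) ∂γ = ∫⁻ x, g x * (1 - w x) ∂π := by
      rw [← lintegral_map (f := fun x => 1 - w x) (hw.const_sub 1) measurable_fst, hγ.1,
        lintegral_withDensity_eq_lintegral_mul _ hg (hw.const_sub 1)]
      rfl
    have h2 : ∫⁻ x, g x * (1 - w x) ∂π + ∫⁻ x, min (f x) (g x) ∂π = 1 := by
      rw [← lintegral_congr_ae hgw, ← lintegral_add_right _ (hg.mul hw)]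
      refine (lintegral_congr fun x => ?_).trans hg1
      rw [Pi.mul_apply, ← mul_add, tsub_add_cancel_of_le (hw1 x), mul_one]
    have h3 : ∫⁻ x, (f x - min (f x) (g x)) ∂π + ∫⁻ x, min (f x) (g x) ∂π = 1 := by
      rw [← lintegral_add_left hfe, ← hf1]
      exact lintegral_congr fun x => tsub_add_cancel_of_le (min_le_left _ _)
    have hfin : ∫⁻ x, min (f x) (g x) ∂π ≠ ∞ := by
      refine ne_top_of_le_ne_top ENNReal.one_ne_top ?_
      rw [← hf1]
      exact lintegral_mono fun x => min_le_left _ _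
    rw [h1]
    exact ((ENNReal.add_left_inj hfin).1 (h2.trans h3.symm)).le
  have htail : ∫⁻ p, ‖p.2‖ₑ ^ 2 * (1 - w p.1) ∂γ
      ≤ R ^ 2 * ∫⁻ p, (1 - w p.1) ∂γ + ∫⁻ y in {y | R < ‖y‖ₑ}, ‖y‖ₑ ^ 2 ∂ν := by
    have hS : MeasurableSet {y : EucSp d | R < ‖y‖ₑ} :=
      measurableSet_lt measurable_const measurable_enorm
    have hwf : Measurable fun p : EucSp d × EucSp d => 1 - w p.1 :=
      (hw.comp measurable_fst).const_sub 1
    rw [← lintegral_indicator hS, ← hγ.2, lintegral_map ((by fun_prop : Measurable fun y : EucSp d =>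
      ‖y‖ₑ ^ 2).indicator hS) measurable_snd, ← lintegral_const_mul _ hwf,
      ← lintegral_add_left (hwf.const_mul _)]
    refine lintegral_mono fun p => ?_
    by_cases hp : R < ‖p.2‖ₑ
    · rw [Set.indicator_of_mem (show p.2 ∈ {y | R < ‖y‖ₑ} from hp)]
      exact le_add_left (mul_le_of_le_one_right' tsub_le_self)
    · rw [Set.indicator_of_notMem (show p.2 ∉ {y | R < ‖y‖ₑ} from hp), add_zero]
      gcongr
      exact not_lt.1 hp
  refine add_le_add (add_le_add le_rfl (mul_le_mul_right (le_of_eq ?_) 2))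
    (mul_le_mul_right (htail.trans (by gcongr)) 2)
  exact lintegral_congr fun x => mul_comm _ _

lemma exists_tail_lt {ν : Measure (EucSp d)} (hν : ∫⁻ y, ‖y‖ₑ ^ 2 ∂ν < ∞) {ε : ℝ≥0∞}
    (hε : 0 < ε) : ∃ R : ℝ≥0∞, R ≠ ∞ ∧ ∫⁻ y in {y | R < ‖y‖ₑ}, ‖y‖ₑ ^ 2 ∂ν < ε := by
  have hm : ∀ R : ℝ≥0∞, MeasurableSet {y : EucSp d | R < ‖y‖ₑ} := fun R =>
    measurableSet_lt measurable_const measurable_enorm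
  have hq : Measurable fun y : EucSp d => ‖y‖ₑ ^ 2 := by fun_prop
  have h : Tendsto (fun n : ℕ => ∫⁻ y, {y : EucSp d | (n : ℝ≥0∞) < ‖y‖ₑ}.indicator
      (fun y => ‖y‖ₑ ^ 2) y ∂ν) atTop (𝓝 (∫⁻ _, 0 ∂ν)) := by
    refine tendsto_lintegral_of_dominated_convergence (fun y => ‖y‖ₑ ^ 2)
      (fun n => hq.indicator (hm n))
      (fun n => ae_of_all _ fun y => Set.indicator_le_self _ _ _) hν.ne (ae_of_all _ fun y => ?_)
    obtain ⟨N, hN⟩ := ENNReal.exists_nat_gt (enorm_ne_top (x := y))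
    refine tendsto_const_nhds.congr' ((eventually_ge_atTop N).mono fun n hn => ?_)
    refine (Set.indicator_of_notMem ?_ _).symm
    exact not_lt.2 (hN.le.trans (Nat.cast_le.2 hn))
  rw [lintegral_zero] at h
  obtain ⟨n, hn⟩ := ((tendsto_order.1 h).2 ε hε).exists
  refine ⟨n, ENNReal.natCast_ne_top n, ?_⟩
  rwa [← lintegral_indicator (hm n)]

/-- Lower semicontinuity of the squared Wasserstein distance along a.e. converging densities. -/
theorem eventually_W2_sq_withDensity_le {π ν : Measure (EucSp d)} [IsProbabilityMeasure ν]
    (hν : ∫⁻ y, ‖y‖ₑ ^ 2 ∂ν < ∞) {f : EucSp d → ℝ≥0∞} {g : ℕ → EucSp d → ℝ≥0∞}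
    (hf : Measurable f) (hg : ∀ n, Measurable (g n)) (hf1 : ∫⁻ x, f x ∂π = 1)
    (hg1 : ∀ n, ∫⁻ x, g n x ∂π = 1) (hf2 : ∫⁻ x, ‖x‖ₑ ^ 2 ∂(π.withDensity f) < ∞)
    (hlim : ∀ᵐ x ∂π, Tendsto (fun n => g n x) atTop (𝓝 (f x))) {ε : ℝ≥0∞} (hε : 0 < ε) :
    ∀ᶠ n in atTop, W2 (π.withDensity f) ν ^ 2 ≤ W2 (π.withDensity (g n)) ν ^ 2 + ε := by
  rw [lintegral_withDensity_eq_lintegral_mul _ hf (by fun_prop)] at hf2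
  have hexc : ∀ᵐ x ∂π, Tendsto (fun n => f x - min (f x) (g n x)) atTop (𝓝 0) := by
    filter_upwards [hlim, ae_lt_top hf (by simp [hf1])] with x hx hfx
    have h := ENNReal.Tendsto.sub (tendsto_const_nhds (x := f x))
      ((tendsto_const_nhds (x := f x)).min hx) (Or.inl hfx.ne)
    rwa [min_self, tsub_self] at h
  have hm : ∀ n, Measurable fun x => f x - min (f x) (g n x) := fun n => hf.sub (hf.min (hg n))
  have h1 : Tendsto (fun n => ∫⁻ x, (f x - min (f x) (g n x)) ∂π) atTop (𝓝 (∫⁻ _, 0 ∂π)) :=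
    tendsto_lintegral_of_dominated_convergence f hm
      (fun n => ae_of_all _ fun x => tsub_le_self) (by simp [hf1]) hexc
  have h2 : Tendsto (fun n => ∫⁻ x, ‖x‖ₑ ^ 2 * (f x - min (f x) (g n x)) ∂π) atTop
      (𝓝 (∫⁻ _, 0 ∂π)) := by
    refine tendsto_lintegral_of_dominated_convergence _ (fun n => Measurable.mul (by fun_prop) (hm n))
      (fun n => ae_of_all _ fun x => ?_) hf2.ne ?_
    · exact (mul_le_mul_right tsub_le_self _).trans_eq (mul_comm _ _)
    · filter_upwards [hexc] with x hx
      have := ENNReal.Tendsto.const_mul (a := ‖x‖ₑ ^ 2) hx (Or.inr (by simp))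
      rwa [mul_zero] at this
  rw [lintegral_zero] at h1 h2
  -- `R` is fixed before `n`: the tail of `ν`, counted twice, stays below `ε`, while the two excess
  -- integrals vanish as `n` grows.
  obtain ⟨R, hR, hRε⟩ := exists_tail_lt hν (ε := ε / 2) (ENNReal.half_pos hε.ne')
  have h3 : Tendsto (fun n => 2 * ∫⁻ x, ‖x‖ₑ ^ 2 * (f x - min (f x) (g n x)) ∂π
        + 2 * (R ^ 2 * ∫⁻ x, (f x - min (f x) (g n x)) ∂π
          + ∫⁻ y in {y | R < ‖y‖ₑ}, ‖y‖ₑ ^ 2 ∂ν)) atTop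
      (𝓝 (2 * 0 + 2 * (R ^ 2 * 0 + ∫⁻ y in {y | R < ‖y‖ₑ}, ‖y‖ₑ ^ 2 ∂ν))) :=
    (ENNReal.Tendsto.const_mul h2 (by simp)).add (ENNReal.Tendsto.const_mul
      ((ENNReal.Tendsto.const_mul h1 (by simp [hR])).add tendsto_const_nhds) (by simp))
  have h4 : 2 * 0 + 2 * (R ^ 2 * 0 + ∫⁻ y in {y | R < ‖y‖ₑ}, ‖y‖ₑ ^ 2 ∂ν) < ε := by
    rw [mul_zero, mul_zero, zero_add, zero_add, mul_comm]
    exact (ENNReal.lt_div_iff_mul_lt (by simp) (by simp)).1 hRε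
  filter_upwards [(tendsto_order.1 h3).2 ε h4] with n hn
  exact (W2_sq_withDensity_le hf (hg n) hf1 (hg1 n) R).trans (by gcongr)

end Wasserstein

/-! ### Uniform convexity and lower semicontinuity of the relative entropy. -/

section Entropy

open InformationTheory

/-- This is `log u ≤ u - 1` at `u = √(m / a)`, multiplied by `2 * a`. -/
lemma two_mul_sub_sqrt_mul_sqrt_le {a m : ℝ} (ha : 0 ≤ a) (hm : 0 < m) :
    2 * (a - √a * √m) ≤ a * Real.log a - a * Real.log m := by
  rcases ha.eq_or_lt with rfl | ha
  · simp
  have hsa : 0 < √a := Real.sqrt_pos.2 ha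
  have hsm : 0 < √m := Real.sqrt_pos.2 hm
  have h := Real.log_le_sub_one_of_pos (div_pos hsm hsa)
  rw [Real.log_div hsm.ne' hsa.ne', Real.log_sqrt hm.le, Real.log_sqrt ha.le] at h
  have h1 := mul_le_mul_of_nonneg_left h ha.le
  have h2 : a * (√m / √a) = √a * √m := by
    nth_rewrite 1 [← Real.mul_self_sqrt ha.le]
    field_simp
  linarith [mul_sub a (√m / √a) 1]

/-- Quantitative midpoint convexity of `klFun`. -/
lemma klFun_midpoint_add_le {a b : ℝ} (ha : 0 ≤ a) (hb : 0 ≤ b) :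
    klFun (2⁻¹ * a + 2⁻¹ * b) + 4⁻¹ * (√a - √b) ^ 2 ≤ 2⁻¹ * klFun a + 2⁻¹ * klFun b := by
  set m := 2⁻¹ * a + 2⁻¹ * b with hm
  have hm0 : 0 ≤ m := by positivity
  rcases hm0.eq_or_lt with h0 | h0
  · have ha0 : a = 0 := by linarith
    have hb0 : b = 0 := by linarith
    rw [← h0, ha0, hb0, klFun_zero]
    norm_num
  have h1 := two_mul_sub_sqrt_mul_sqrt_le ha h0
  have h2 := two_mul_sub_sqrt_mul_sqrt_le hb h0
  have h3 : (a + b) * Real.log m = 2 * (m * Real.log m) := by rw [hm]; ring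
  have ea := Real.sq_sqrt ha
  have eb := Real.sq_sqrt hb
  have em := Real.sq_sqrt h0.le
  simp only [klFun_apply]
  -- After adding `h1` and `h2`, the remaining slack is exactly `(2√m - √a - √b)² / 4`.
  nlinarith [sq_nonneg (2 * √m - (√a + √b))]

lemma abs_sub_le_sq_sqrt_sub_add {a b t : ℝ} (ha : 0 ≤ a) (hb : 0 ≤ b) (ht : 0 < t) :
    |a - b| ≤ 1 / (2 * t) * (√a - √b) ^ 2 + t * (a + b) := by
  have ea := Real.sq_sqrt ha
  have eb := Real.sq_sqrt hb
  have h1 : a - b = (√a - √b) * (√a + √b) := by linarith [sq_sub_sq (√a) (√b)]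
  have h2 : |a - b| = |√a - √b| * (√a + √b) := by
    rw [h1, abs_mul, abs_of_nonneg (a := √a + √b) (by positivity)]
  have h3 : |√a - √b| * (√a + √b)
      ≤ 1 / (2 * t) * |√a - √b| ^ 2 + t / 2 * (√a + √b) ^ 2 := by
    have h : 0 ≤ 1 / (2 * t) * (|√a - √b| - t * (√a + √b)) ^ 2 := by positivity
    have h' : 1 / (2 * t) * (|√a - √b| - t * (√a + √b)) ^ 2
      = 1 / (2 * t) * |√a - √b| ^ 2 + t / 2 * (√a + √b) ^ 2 - |√a - √b| * (√a + √b) := by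
      field_simp
      ring
    linarith
  rw [sq_abs] at h3
  rw [h2]
  have h4 : t / 2 * (√a + √b) ^ 2 ≤ t * (a + b) := by
    have : (√a + √b) ^ 2 ≤ 2 * (a + b) := by nlinarith [sq_nonneg (√a - √b)]
    linarith [mul_le_mul_of_nonneg_left this (half_pos ht).le]
  linarith

variable {α : Type*} [MeasurableSpace α] {π : Measure α}

/-- The squared Hellinger distance between the densities `f` and `g`. -/
noncomputable def hellingerSq (π : Measure α) (f g : α → ℝ≥0∞) : ℝ≥0∞ :=
  ∫⁻ x, ENNReal.ofReal ((√(f x).toReal - √(g x).toReal) ^ 2) ∂π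

lemma klDiv_withDensity [IsFiniteMeasure π] {f : α → ℝ≥0∞} (hf : Measurable f)
    (hf1 : ∫⁻ x, f x ∂π ≠ ∞) :
    klDiv (π.withDensity f) π = ∫⁻ x, ENNReal.ofReal (klFun (f x).toReal) ∂π := by
  have := isFiniteMeasure_withDensity hf1
  rw [klDiv_eq_lintegral_klFun_of_ac (withDensity_absolutelyContinuous π f)]
  refine lintegral_congr_ae ?_
  filter_upwards [Measure.rnDeriv_withDensity π hf] with x hx
  rw [hx]

lemma klDiv_midpoint_add_hellingerSq_le [IsFiniteMeasure π] {f g : α → ℝ≥0∞} (hf : Measurable f)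
    (hg : Measurable g) (hf1 : ∫⁻ x, f x ∂π ≠ ∞) (hg1 : ∫⁻ x, g x ∂π ≠ ∞) :
    klDiv ((2⁻¹ : ℝ≥0∞) • π.withDensity f + (2⁻¹ : ℝ≥0∞) • π.withDensity g) π
        + 4⁻¹ * hellingerSq π f g
      ≤ 2⁻¹ * klDiv (π.withDensity f) π + 2⁻¹ * klDiv (π.withDensity g) π := by
  have hm : Measurable fun x => 2⁻¹ * f x + 2⁻¹ * g x := (hf.const_mul _).add (hg.const_mul _)
  have hm1 : ∫⁻ x, (2⁻¹ * f x + 2⁻¹ * g x) ∂π ≠ ∞ := by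
    rw [lintegral_add_left (hf.const_mul _), lintegral_const_mul _ hf, lintegral_const_mul _ hg]
    exact ENNReal.add_ne_top.2 ⟨ENNReal.mul_ne_top (by simp) hf1, ENNReal.mul_ne_top (by simp) hg1⟩
  have hmid : (2⁻¹ : ℝ≥0∞) • π.withDensity f + (2⁻¹ : ℝ≥0∞) • π.withDensity g
      = π.withDensity fun x => 2⁻¹ * f x + 2⁻¹ * g x := by
    rw [← withDensity_smul _ hf, ← withDensity_smul _ hg,
      ← withDensity_add_left (hf.const_smul _)]
    rfl
  have hk : ∀ {h : α → ℝ≥0∞}, Measurable h →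
      Measurable fun x => ENNReal.ofReal (klFun (h x).toReal) := fun hh =>
    (measurable_klFun.comp hh.ennreal_toReal).ennreal_ofReal
  rw [hmid, klDiv_withDensity hm hm1, klDiv_withDensity hf hf1, klDiv_withDensity hg hg1,
    hellingerSq, ← lintegral_const_mul _ (by fun_prop), ← lintegral_const_mul _ (hk hf),
    ← lintegral_const_mul _ (hk hg), ← lintegral_add_left (hk hm),
    ← lintegral_add_left ((hk hf).const_mul _)]
  refine lintegral_mono_ae ?_
  filter_upwards [ae_lt_top hf hf1, ae_lt_top hg hg1] with x hfx hgx
  have e2 : (2⁻¹ : ℝ≥0∞) = ENNReal.ofReal 2⁻¹ := by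
    rw [ENNReal.ofReal_inv_of_pos two_pos, ENNReal.ofReal_ofNat]
  have e4 : (4⁻¹ : ℝ≥0∞) = ENNReal.ofReal 4⁻¹ := by
    rw [ENNReal.ofReal_inv_of_pos four_pos, ENNReal.ofReal_ofNat]
  have hkf := klFun_nonneg (x := (f x).toReal) ENNReal.toReal_nonneg
  have hkg := klFun_nonneg (x := (g x).toReal) ENNReal.toReal_nonneg
  have ht : (2⁻¹ * f x + 2⁻¹ * g x).toReal = 2⁻¹ * (f x).toReal + 2⁻¹ * (g x).toReal := by
    rw [ENNReal.toReal_add (ENNReal.mul_ne_top (by simp) hfx.ne)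
      (ENNReal.mul_ne_top (by simp) hgx.ne), ENNReal.toReal_mul, ENNReal.toReal_mul]
    simp
  rw [ht, e2, e4, ← ENNReal.ofReal_mul (by positivity), ← ENNReal.ofReal_mul (by positivity),
    ← ENNReal.ofReal_mul (by positivity),
    ← ENNReal.ofReal_add (klFun_nonneg (by positivity)) (by positivity),
    ← ENNReal.ofReal_add (by positivity) (by positivity)]
  exact ENNReal.ofReal_le_ofReal
    (klFun_midpoint_add_le ENNReal.toReal_nonneg ENNReal.toReal_nonneg)

/-- Integrates `abs_sub_le_sq_sqrt_sub_add`, a weighted Young inequality, using total mass two. The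
free parameter `t` replaces the square root in the Cauchy–Schwarz form. -/
lemma eLpNorm_sub_le_hellingerSq {f g : α → ℝ≥0∞} (hf : Measurable f) (hg : Measurable g)
    (hf1 : ∫⁻ x, f x ∂π = 1) (hg1 : ∫⁻ x, g x ∂π = 1) {t : ℝ} (ht : 0 < t) :
    eLpNorm ((fun x => (f x).toReal) - fun x => (g x).toReal) 1 π
      ≤ ENNReal.ofReal (1 / (2 * t)) * hellingerSq π f g + ENNReal.ofReal (2 * t) := by
  have hs : ENNReal.ofReal (2 * t) = ∫⁻ x, ENNReal.ofReal t * (f x + g x) ∂π := by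
    rw [lintegral_const_mul _ (by fun_prop), lintegral_add_left hf, hf1, hg1, one_add_one_eq_two,
      mul_comm 2 t, ENNReal.ofReal_mul ht.le, ENNReal.ofReal_ofNat]
  rw [eLpNorm_one_eq_lintegral_enorm, hs, hellingerSq, ← lintegral_const_mul _ (by fun_prop),
    ← lintegral_add_left (by fun_prop)]
  refine lintegral_mono_ae ?_
  filter_upwards [ae_lt_top hf (by simp [hf1]), ae_lt_top hg (by simp [hg1])] with x hfx hgx
  have hfg : f x + g x = ENNReal.ofReal ((f x).toReal + (g x).toReal) := by
    rw [← ENNReal.toReal_add hfx.ne hgx.ne, ENNReal.ofReal_toReal]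
    exact (ENNReal.add_lt_top.2 ⟨hfx, hgx⟩).ne
  rw [hfg, ← ENNReal.ofReal_mul (by positivity), ← ENNReal.ofReal_mul ht.le,
    ← ENNReal.ofReal_add (by positivity) (by positivity), Pi.sub_apply, Real.enorm_eq_ofReal_abs]
  exact ENNReal.ofReal_le_ofReal
    (abs_sub_le_sq_sqrt_sub_add ENNReal.toReal_nonneg ENNReal.toReal_nonneg ht)

lemma ae_eq_of_hellingerSq_eq_zero {f g : α → ℝ≥0∞} (hf : Measurable f) (hg : Measurable g)
    (hf1 : ∫⁻ x, f x ∂π ≠ ∞) (hg1 : ∫⁻ x, g x ∂π ≠ ∞) (h : hellingerSq π f g = 0) :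
    f =ᵐ[π] g := by
  rw [hellingerSq, lintegral_eq_zero_iff (by fun_prop)] at h
  filter_upwards [h, ae_lt_top hf hf1, ae_lt_top hg hg1] with x hx hfx hgx
  rw [Pi.zero_apply, ENNReal.ofReal_eq_zero] at hx
  have h0 := sub_eq_zero.1 (pow_eq_zero_iff two_ne_zero |>.1 (le_antisymm hx (sq_nonneg _)))
  rw [Real.sqrt_inj ENNReal.toReal_nonneg ENNReal.toReal_nonneg] at h0
  exact (ENNReal.toReal_eq_toReal_iff' hfx.ne hgx.ne).1 h0

/-- Lower semicontinuity of the relative entropy along a.e. converging densities. -/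
lemma klDiv_withDensity_le_liminf [IsFiniteMeasure π] {f : α → ℝ≥0∞} {g : ℕ → α → ℝ≥0∞}
    (hf : Measurable f) (hg : ∀ n, Measurable (g n)) (hf1 : ∫⁻ x, f x ∂π ≠ ∞)
    (hg1 : ∀ n, ∫⁻ x, g n x ∂π ≠ ∞)
    (hlim : ∀ᵐ x ∂π, Tendsto (fun n => g n x) atTop (𝓝 (f x))) :
    klDiv (π.withDensity f) π ≤ liminf (fun n => klDiv (π.withDensity (g n)) π) atTop := by
  simp only [klDiv_withDensity hf hf1, klDiv_withDensity (hg _) (hg1 _)]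
  refine le_trans (le_of_eq (lintegral_congr_ae ?_)) (lintegral_liminf_le fun n =>
    (measurable_klFun.comp (hg n).ennreal_toReal).ennreal_ofReal)
  filter_upwards [hlim, ae_lt_top hf hf1] with x hx hfx
  refine (Tendsto.liminf_eq ?_).symm
  exact (ENNReal.continuous_ofReal.comp continuous_klFun).continuousAt.tendsto.comp
    ((ENNReal.tendsto_toReal hfx.ne).comp hx)

/-- Probability densities that are rapidly Cauchy in `L¹` converge a.e. to a probability
density. -/
lemma exists_tendsto_density {g : ℕ → α → ℝ≥0∞} (hg : ∀ n, Measurable (g n))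
    (hg1 : ∀ n, ∫⁻ x, g n x ∂π = 1) {B : ℕ → ℝ≥0∞} (hB : ∑' n, B n ≠ ∞)
    (hcau : ∀ N n m : ℕ, N ≤ n → N ≤ m →
      eLpNorm ((fun x => (g n x).toReal) - fun x => (g m x).toReal) 1 π < B N) :
    ∃ f : α → ℝ≥0∞, Measurable f ∧ ∫⁻ x, f x ∂π = 1 ∧
      ∀ᵐ x ∂π, Tendsto (fun n => g n x) atTop (𝓝 (f x)) := by
  have hgm : ∀ n, AEStronglyMeasurable (fun x => (g n x).toReal) π := fun n =>
    (hg n).ennreal_toReal.aestronglyMeasurable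
  obtain ⟨f, hf, hlim⟩ := measurable_limit_of_tendsto_metrizable_ae
    (fun n => (hgm n).aemeasurable)
    (Lp.ae_tendsto_of_cauchy_eLpNorm hgm le_rfl hB hcau)
  have hgi : ∀ n, Integrable (fun x => (g n x).toReal) π := fun n =>
    integrable_toReal_of_lintegral_ne_top (hg n).aemeasurable (by simp [hg1])
  have hL1 := Lp.cauchy_tendsto_of_tendsto hgm f hB hcau hlim
  simp only [eLpNorm_one_eq_lintegral_enorm, Pi.sub_apply] at hL1
  have hf0 : 0 ≤ᵐ[π] f := by
    filter_upwards [hlim] with x hx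
    exact ge_of_tendsto' hx fun n => ENNReal.toReal_nonneg
  have hfi : Integrable f π := by
    obtain ⟨n, hn⟩ := ((tendsto_order.1 hL1).2 1 one_pos).exists
    have hd : Integrable (fun x => (g n x).toReal - f x) π :=
      ⟨(hgm n).sub hf.aestronglyMeasurable, hn.trans ENNReal.one_lt_top⟩
    refine ((hgi n).sub hd).congr (ae_of_all _ fun x => ?_)
    simp
  -- A.e. convergence alone could lose mass; the `L¹` convergence `hL1` preserves it.
  have hint : ∫ x, f x ∂π = 1 := by
    refine tendsto_nhds_unique (tendsto_integral_of_L1 f hf.aestronglyMeasurable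
      (Eventually.of_forall hgi) hL1) ?_
    have : ∀ n, ∫ x, (g n x).toReal ∂π = 1 := fun n => by
      rw [integral_toReal (hg n).aemeasurable (ae_lt_top (hg n) (by simp [hg1])), hg1,
        ENNReal.toReal_one]
    simp only [this]
    exact tendsto_const_nhds
  refine ⟨fun x => ENNReal.ofReal (f x), hf.ennreal_ofReal, ?_, ?_⟩
  · rw [← ofReal_integral_eq_lintegral_ofReal hfi hf0, hint, ENNReal.ofReal_one]
  · have hfin : ∀ᵐ x ∂π, ∀ n, g n x < ∞ :=
      ae_all_iff.2 fun n => ae_lt_top (hg n) (by simp [hg1])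
    filter_upwards [hlim, hfin] with x hx hgx
    refine ((ENNReal.continuous_ofReal.tendsto _).comp hx).congr fun n => ?_
    exact ENNReal.ofReal_toReal (hgx n).ne

end Entropy

/-! ### The Gibbs measure of a potential with quadratic growth. -/

section Gibbs

variable {d : ℕ}

lemma exists_quadratic_lower_bound {U : EucSp d → ℝ} (hU : Continuous U)
    (hUgrowth : 0 < liminf (fun x => ((U x / ‖x‖ ^ 2 : ℝ) : EReal)) (cocompact (EucSp d))) :
    ∃ c > 0, ∃ M, ∀ x, c * ‖x‖ ^ 2 - M ≤ U x := by
  obtain ⟨c, hc0, hc⟩ := EReal.lt_iff_exists_real_btwn.1 hUgrowth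
  have hc0' : 0 < c := EReal.coe_pos.1 hc0
  have hev := eventually_lt_of_lt_liminf hc
  obtain ⟨K, hK, hKU⟩ := mem_cocompact.1 hev
  obtain ⟨M, hM⟩ := hK.exists_bound_of_continuousOn
    (f := fun x => c * ‖x‖ ^ 2 - U x) (by fun_prop)
  refine ⟨c, hc0', max M 0, fun x => ?_⟩
  by_cases hx : x ∈ K
  · have := (le_abs_self _).trans (hM x hx)
    linarith [le_max_left M 0]
  · have h : c < U x / ‖x‖ ^ 2 := EReal.coe_lt_coe_iff.1 (hKU hx)
    have hx0 : 0 < ‖x‖ ^ 2 := by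
      rcases (sq_nonneg ‖x‖).eq_or_lt with h0 | h0
      · rw [← h0, div_zero] at h
        exact absurd h hc0'.not_gt
      · exact h0
    rw [lt_div_iff₀ hx0] at h
    linarith [le_max_right M 0]

lemma integrable_exp_neg_mul_norm_sq {c : ℝ} (hc : 0 < c) :
    Integrable (fun x : EucSp d => Real.exp (-c * ‖x‖ ^ 2)) := by
  have h := (GaussianFourier.integrable_cexp_neg_mul_sq_norm_add (V := EucSp d) (b := c)
    (by simpa using hc) 0 0).norm
  refine h.congr (ae_of_all _ fun x => ?_)
  simp [Complex.norm_exp, ← Complex.ofReal_pow]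

/-- A potential with quadratic growth has a Gibbs measure in `𝒫₂`. -/
lemma gibbsMeasure_mem {U : EucSp d → ℝ} (hU : Continuous U) {c M : ℝ} (hc : 0 < c)
    (hUc : ∀ x, c * ‖x‖ ^ 2 - M ≤ U x) :
    IsProbabilityMeasure (gibbsMeasure U) ∧ ∫⁻ x, ‖x‖ₑ ^ 2 ∂(gibbsMeasure U) < ∞ := by
  have hle : ∀ x, Real.exp (-U x) ≤ Real.exp M * Real.exp (-c * ‖x‖ ^ 2) := fun x => by
    rw [← Real.exp_add]
    exact Real.exp_le_exp.2 (by linarith [hUc x])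
  have hi : Integrable (fun x => Real.exp (-U x)) :=
    ((integrable_exp_neg_mul_norm_sq hc).const_mul (Real.exp M)).mono'
      (by fun_prop) (ae_of_all _ fun x => by
        rw [Real.norm_of_nonneg (Real.exp_pos _).le]; exact hle x)
  refine ⟨isProbabilityMeasure_tilted hi, ?_⟩
  rw [lintegral_enorm_sq_lt_top_iff, gibbsMeasure, integrable_tilted_iff hi]
  refine ((integrable_exp_neg_mul_norm_sq (half_pos hc)).const_mul
    (Real.exp M * (2 / c))).mono' (by fun_prop) (ae_of_all _ fun x => ?_)
  rw [smul_eq_mul, Real.norm_of_nonneg (by positivity)]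
  -- Half of the Gaussian decay absorbs the factor `‖x‖²`, through `t ≤ exp t`.
  have h1 : ‖x‖ ^ 2 ≤ 2 / c * Real.exp (c / 2 * ‖x‖ ^ 2) := by
    have := Real.add_one_le_exp (c / 2 * ‖x‖ ^ 2)
    calc ‖x‖ ^ 2 = 2 / c * (c / 2 * ‖x‖ ^ 2) := by field_simp
      _ ≤ _ := by gcongr; linarith
  calc Real.exp (-U x) * ‖x‖ ^ 2
      ≤ (Real.exp M * Real.exp (-c * ‖x‖ ^ 2)) * (2 / c * Real.exp (c / 2 * ‖x‖ ^ 2)) := by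
        gcongr
        exact hle x
    _ = Real.exp M * (2 / c) * (Real.exp (-c * ‖x‖ ^ 2) * Real.exp (c / 2 * ‖x‖ ^ 2)) := by ring
    _ = _ := by
      rw [← Real.exp_add]
      congr 2
      ring

end Gibbs

/-! ### Existence and uniqueness of the minimizer of the JKO functional. -/

section JKO

open InformationTheory

variable {d : ℕ}

/-- The midpoint of two measures. -/
noncomputable def P2.midpoint (μ μ' : P2 d) : P2 d :=
  μ.mix μ' ⟨2⁻¹, by norm_num, by norm_num⟩

lemma P2.midpoint_toMeasure (μ μ' : P2 d) : (μ.midpoint μ').toMeasure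
    = (2⁻¹ : ℝ≥0∞) • μ.toMeasure + (2⁻¹ : ℝ≥0∞) • μ'.toMeasure := by
  have h : ENNReal.ofReal 2⁻¹ = 2⁻¹ := by
    rw [ENNReal.ofReal_inv_of_pos two_pos, ENNReal.ofReal_ofNat]
  have h' : (1 - 2⁻¹ : ℝ) = 2⁻¹ := by norm_num
  change ENNReal.ofReal (1 - 2⁻¹) • μ.toMeasure + ENNReal.ofReal 2⁻¹ • μ'.toMeasure = _
  rw [h', h]

lemma P2.midpoint_mem {μ μ' : P2 d} (hμ : μ ∈ P2ac d) (hμ' : μ' ∈ P2ac d) :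
    μ.midpoint μ' ∈ P2ac d := by
  change (μ.midpoint μ').toMeasure ≪ volume
  rw [P2.midpoint_toMeasure]
  exact (Measure.AbsolutelyContinuous.smul_left hμ _).add_left
    (Measure.AbsolutelyContinuous.smul_left hμ' _)

lemma exists_density_of_jkoFunctional_ne_top {σ τ : ℝ} (hσ : 0 < σ)
    {π ν : Measure (EucSp d)} [IsProbabilityMeasure π] {μ : P2 d}
    (h : jkoFunctional σ τ π ν μ ≠ ∞) :
    ∃ f : EucSp d → ℝ≥0∞, Measurable f ∧ ∫⁻ x, f x ∂π = 1 ∧ μ.toMeasure = π.withDensity f := by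
  have hk : klDiv μ.toMeasure π ≠ ∞ := by
    intro hk
    refine h ?_
    rw [jkoFunctional, hk, ENNReal.mul_top (ENNReal.ofReal_pos.2 hσ).ne', top_add]
  have hac := (klDiv_ne_top_iff.1 hk).1
  have hsμ : SigmaFinite μ.toMeasure := IsFiniteMeasure.toSigmaFinite _
  have hsπ : SigmaFinite π := IsFiniteMeasure.toSigmaFinite _
  refine ⟨μ.toMeasure.rnDeriv π, Measure.measurable_rnDeriv _ _, ?_,
    (Measure.withDensity_rnDeriv_eq _ _ hac).symm⟩
  rw [Measure.lintegral_rnDeriv hac, measure_univ]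

lemma jkoFunctional_midpoint_add_le (σ τ : ℝ) {π : Measure (EucSp d)} (ν : Measure (EucSp d))
    [IsProbabilityMeasure π] {μ μ' : P2 d} {f g : EucSp d → ℝ≥0∞}
    (hf : Measurable f) (hg : Measurable g) (hf1 : ∫⁻ x, f x ∂π = 1) (hg1 : ∫⁻ x, g x ∂π = 1)
    (hμ : μ.toMeasure = π.withDensity f) (hμ' : μ'.toMeasure = π.withDensity g) :
    jkoFunctional σ τ π ν (μ.midpoint μ') + ENNReal.ofReal σ * (4⁻¹ * hellingerSq π f g)
      ≤ 2⁻¹ * jkoFunctional σ τ π ν μ + 2⁻¹ * jkoFunctional σ τ π ν μ' := by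
  have h1 := klDiv_midpoint_add_hellingerSq_le (π := π) hf hg (by simp [hf1]) (by simp [hg1])
  have h2 := W2_sq_midpoint_le μ.toMeasure μ'.toMeasure ν
  rw [← hμ, ← hμ', ← P2.midpoint_toMeasure] at h1
  rw [← P2.midpoint_toMeasure] at h2
  simp only [jkoFunctional]
  calc _ = ENNReal.ofReal σ
          * (klDiv (μ.midpoint μ').toMeasure π + 4⁻¹ * hellingerSq π f g)
        + ENNReal.ofReal (1 / (2 * τ)) * W2 (μ.midpoint μ').toMeasure ν ^ 2 := by ring
    _ ≤ ENNReal.ofReal σ * (2⁻¹ * klDiv μ.toMeasure π + 2⁻¹ * klDiv μ'.toMeasure π)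
        + ENNReal.ofReal (1 / (2 * τ))
          * (2⁻¹ * W2 μ.toMeasure ν ^ 2 + 2⁻¹ * W2 μ'.toMeasure ν ^ 2) := by gcongr
    _ = _ := by ring

lemma half_add_half_le {a b c : ℝ≥0∞} (ha : a ≤ c) (hb : b ≤ c) : 2⁻¹ * a + 2⁻¹ * b ≤ c := by
  calc 2⁻¹ * a + 2⁻¹ * b ≤ 2⁻¹ * c + 2⁻¹ * c := by gcongr
    _ = c := by rw [← add_mul, ENNReal.inv_two_add_inv_two, one_mul]

/-- Near-minimizers of the JKO functional have Hellinger-close densities. -/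
lemma hellingerSq_le_of_le_iInf_add {σ τ : ℝ} {π ν : Measure (EucSp d)}
    [IsProbabilityMeasure π] {μ μ' : P2 d} {f g : EucSp d → ℝ≥0∞}
    (hf : Measurable f) (hg : Measurable g) (hf1 : ∫⁻ x, f x ∂π = 1) (hg1 : ∫⁻ x, g x ∂π = 1)
    (hμ : μ.toMeasure = π.withDensity f) (hμ' : μ'.toMeasure = π.withDensity g)
    (hac : μ ∈ P2ac d) (hac' : μ' ∈ P2ac d) {I δ : ℝ≥0∞} (hI : I ≠ ∞)
    (hmin : ∀ μ ∈ P2ac d, I ≤ jkoFunctional σ τ π ν μ)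
    (h : jkoFunctional σ τ π ν μ ≤ I + δ) (h' : jkoFunctional σ τ π ν μ' ≤ I + δ) :
    ENNReal.ofReal σ * (4⁻¹ * hellingerSq π f g) ≤ δ := by
  have h1 := (jkoFunctional_midpoint_add_le σ τ ν hf hg hf1 hg1 hμ hμ').trans
    (half_add_half_le h h')
  have h2 := (add_le_add_left (hmin _ (P2.midpoint_mem hac hac'))
    (ENNReal.ofReal σ * (4⁻¹ * hellingerSq π f g))).trans h1
  exact (ENNReal.add_le_add_iff_left hI).1 h2

lemma P2.ext_toMeasure {μ μ' : P2 d} (h : μ.toMeasure = μ'.toMeasure) : μ = μ' := Subtype.ext h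

theorem jkoFunctional_minimizer_unique {σ τ : ℝ} (hσ : 0 < σ) {π ν : Measure (EucSp d)}
    [IsProbabilityMeasure π] {μ μ' : P2 d} (hac : μ ∈ P2ac d) (hac' : μ' ∈ P2ac d)
    (hmin : IsMinOn (jkoFunctional σ τ π ν) (P2ac d) μ)
    (hmin' : IsMinOn (jkoFunctional σ τ π ν) (P2ac d) μ')
    (hfin : jkoFunctional σ τ π ν μ ≠ ∞) : μ = μ' := by
  have heq : jkoFunctional σ τ π ν μ' = jkoFunctional σ τ π ν μ :=
    le_antisymm (isMinOn_iff.1 hmin' μ hac) (isMinOn_iff.1 hmin μ' hac')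
  obtain ⟨f, hf, hf1, hμ⟩ := exists_density_of_jkoFunctional_ne_top hσ hfin
  obtain ⟨g, hg, hg1, hμ'⟩ := exists_density_of_jkoFunctional_ne_top hσ (heq.trans_ne hfin)
  have h := hellingerSq_le_of_le_iInf_add hf hg hf1 hg1 hμ hμ' hac hac' hfin
    (isMinOn_iff.1 hmin) (δ := 0) (by simp) (by simp [heq])
  have h0 : hellingerSq π f g = 0 := by
    simpa [(ENNReal.ofReal_pos.2 hσ).ne', hσ.not_ge] using h
  apply P2.ext_toMeasure
  rw [hμ, hμ', withDensity_congr_ae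
    (ae_eq_of_hellingerSq_eq_zero hf hg (by simp [hf1]) (by simp [hg1]) h0)]

/-- The JKO functional is lower semicontinuous along a.e. converging densities of bounded
energy. -/
lemma exists_jkoFunctional_le_of_tendsto {σ τ : ℝ} (hτ : 0 < τ)
    {π ν : Measure (EucSp d)} [IsProbabilityMeasure π] [IsProbabilityMeasure ν]
    (hπ : π ≪ volume) (hν : ∫⁻ x, ‖x‖ₑ ^ 2 ∂ν < ∞) {μ : ℕ → P2 d} {f : EucSp d → ℝ≥0∞}
    {g : ℕ → EucSp d → ℝ≥0∞} (hf : Measurable f) (hg : ∀ n, Measurable (g n))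
    (hf1 : ∫⁻ x, f x ∂π = 1) (hg1 : ∀ n, ∫⁻ x, g n x ∂π = 1)
    (hμ : ∀ n, (μ n).toMeasure = π.withDensity (g n))
    (hlim : ∀ᵐ x ∂π, Tendsto (fun n => g n x) atTop (𝓝 (f x))) {I : ℝ≥0∞} (hI : I ≠ ∞)
    (hle : ∀ ε > 0, ∀ᶠ n in atTop, jkoFunctional σ τ π ν (μ n) ≤ I + ε) :
    ∃ m ∈ P2ac d, jkoFunctional σ τ π ν m ≤ I := by
  set c := ENNReal.ofReal (1 / (2 * τ)) with hc
  have hc0 : c ≠ 0 := (ENNReal.ofReal_pos.2 (by positivity)).ne'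
  have hcT : c ≠ ∞ := ENNReal.ofReal_ne_top
  have hprob : IsProbabilityMeasure (π.withDensity f) :=
    ⟨by rw [withDensity_apply _ MeasurableSet.univ, Measure.restrict_univ, hf1]⟩
  have hW : ∀ n, c * W2 (π.withDensity (g n)) ν ^ 2 ≤ jkoFunctional σ τ π ν (μ n) := fun n => by
    rw [← hμ]
    exact le_add_self
  have h2 : ∫⁻ x, ‖x‖ₑ ^ 2 ∂(π.withDensity f) < ∞ := by
    have hm : ∀ n, Measurable fun x : EucSp d => g n x * ‖x‖ₑ ^ 2 := fun n =>
      (hg n).mul (by fun_prop)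
    -- The transport term is coercive: bounded energy bounds the second moments, and Fatou passes
    -- the bound to the limit.
    have hb : ∀ᶠ n in atTop, ∫⁻ x, g n x * ‖x‖ₑ ^ 2 ∂π
        ≤ 2 * (c⁻¹ * (I + 1)) + 2 * ∫⁻ y, ‖y‖ₑ ^ 2 ∂ν := by
      filter_upwards [hle 1 one_pos] with n hn
      have h := second_moment_le (π.withDensity (g n)) ν
      rw [lintegral_withDensity_eq_lintegral_mul _ (hg n) (by fun_prop)] at h
      refine h.trans ?_
      gcongr
      rw [← ENNReal.div_eq_inv_mul, ENNReal.le_div_iff_mul_le (Or.inl hc0) (Or.inl hcT), mul_comm]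
      exact (hW n).trans hn
    rw [lintegral_withDensity_eq_lintegral_mul _ hf (by fun_prop)]
    have hbfin : 2 * (c⁻¹ * (I + 1)) + 2 * ∫⁻ y, ‖y‖ₑ ^ 2 ∂ν < ∞ := ENNReal.add_lt_top.2
      ⟨ENNReal.mul_lt_top ENNReal.ofNat_lt_top (ENNReal.mul_lt_top (ENNReal.inv_lt_top.2 hc0.bot_lt)
        (ENNReal.add_lt_top.2 ⟨hI.lt_top, ENNReal.one_lt_top⟩)),
        ENNReal.mul_lt_top ENNReal.ofNat_lt_top hν⟩
    refine lt_of_le_of_lt ?_ hbfin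
    refine le_trans (le_of_eq (lintegral_congr_ae ?_)) ((lintegral_liminf_le hm).trans
      (liminf_le_of_frequently_le' hb.frequently))
    filter_upwards [hlim] with x hx
    exact (ENNReal.Tendsto.mul_const hx (Or.inr (by simp))).liminf_eq.symm
  let m : P2 d := ⟨π.withDensity f, hprob, h2⟩
  refine ⟨m, (withDensity_absolutelyContinuous π f).trans hπ, ?_⟩
  change ENNReal.ofReal σ * klDiv (π.withDensity f) π + c * W2 (π.withDensity f) ν ^ 2 ≤ I
  have hWfin : c * W2 (π.withDensity f) ν ^ 2 ≠ ∞ :=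
    ENNReal.mul_ne_top hcT (W2_sq_lt_top h2 hν).ne
  refine ENNReal.le_of_forall_pos_le_add fun ε hε _ => ?_
  have hε' : (0 : ℝ≥0∞) < ε / 2 := ENNReal.half_pos (by simpa using hε.ne')
  -- The transport term is replaced by its limiting value first, so that it is constant in `n` and
  -- only the entropy goes through the liminf.
  have hev : ∀ᶠ n in atTop, ENNReal.ofReal σ * klDiv (π.withDensity (g n)) π
      + c * W2 (π.withDensity f) ν ^ 2 ≤ I + ε := by
    filter_upwards [hle _ hε', eventually_W2_sq_withDensity_le hν hf hg hf1 hg1 h2 hlim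
      (ENNReal.div_pos hε'.ne' hcT)] with n hn hn'
    have h3 : c * W2 (π.withDensity f) ν ^ 2 ≤ c * W2 (π.withDensity (g n)) ν ^ 2 + ε / 2 := by
      calc _ ≤ c * (W2 (π.withDensity (g n)) ν ^ 2 + ε / 2 / c) := by gcongr
        _ = _ := by rw [mul_add, ENNReal.mul_div_cancel hc0 hcT]
    rw [jkoFunctional, hμ] at hn
    calc _ ≤ ENNReal.ofReal σ * klDiv (π.withDensity (g n)) π
          + (c * W2 (π.withDensity (g n)) ν ^ 2 + ε / 2) := by gcongr
      _ ≤ I + ε / 2 + ε / 2 := by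
        rw [← add_assoc]
        gcongr
      _ = I + ε := by rw [add_assoc, ENNReal.add_halves]
  have hWle : c * W2 (π.withDensity f) ν ^ 2 ≤ I + ε := by
    obtain ⟨n, hn⟩ := hev.exists
    exact le_add_self.trans hn
  have hk : ENNReal.ofReal σ * klDiv (π.withDensity f) π
      ≤ I + ε - c * W2 (π.withDensity f) ν ^ 2 := by
    calc _ ≤ ENNReal.ofReal σ * liminf (fun n => klDiv (π.withDensity (g n)) π) atTop := by
          gcongr
          exact klDiv_withDensity_le_liminf hf hg (by simp [hf1]) (fun n => by simp [hg1 n]) hlim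
      _ ≤ liminf (fun n => ENNReal.ofReal σ * klDiv (π.withDensity (g n)) π) atTop :=
          (ENNReal.liminf_const_mul_of_ne_top ENNReal.ofReal_ne_top).ge
      _ ≤ _ := liminf_le_of_frequently_le' (hev.mono fun n hn =>
          ENNReal.le_sub_of_add_le_right hWfin hn).frequently
  calc _ ≤ I + ε - c * W2 (π.withDensity f) ν ^ 2 + c * W2 (π.withDensity f) ν ^ 2 := by gcongr
    _ = I + ε := tsub_add_cancel_of_le hWle

theorem exists_jkoFunctional_minimizer {σ τ : ℝ} (hσ : 0 < σ) (hτ : 0 < τ)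
    {π ν : Measure (EucSp d)} [IsProbabilityMeasure π] [IsProbabilityMeasure ν]
    (hπ : π ≪ volume) (hν : ∫⁻ x, ‖x‖ₑ ^ 2 ∂ν < ∞)
    (hfin : ∃ μ ∈ P2ac d, jkoFunctional σ τ π ν μ ≠ ∞) :
    ∃ μ ∈ P2ac d, IsMinOn (jkoFunctional σ τ π ν) (P2ac d) μ := by
  set I := ⨅ μ ∈ P2ac d, jkoFunctional σ τ π ν μ
  have hmin : ∀ μ ∈ P2ac d, I ≤ jkoFunctional σ τ π ν μ := fun μ hμ => iInf₂_le μ hμ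
  have hI : I ≠ ∞ := by
    obtain ⟨μ, hμ, hμ'⟩ := hfin
    exact ne_top_of_le_ne_top hμ' (hmin μ hμ)
  let e : ℕ → ℝ := fun n => (1 / 2) ^ n
  have he : ∀ n, 0 < e n := fun n => by positivity
  -- Chosen so that the squared Hellinger distance is at most `e² / 8`. With `t = e / 8` the `L¹`
  -- distance is then at most `e / 2 + e / 4 < e`, and the `e n` are summable.
  let δ : ℕ → ℝ≥0∞ := fun n => ENNReal.ofReal (σ * (4⁻¹ * (e n ^ 2 / 8)))
  have hδ : ∀ n, 0 < δ n := fun n => ENNReal.ofReal_pos.2 (by have := he n; positivity)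
  have hex : ∀ n, ∃ μ ∈ P2ac d, jkoFunctional σ τ π ν μ < I + δ n := fun n => by
    have := ENNReal.lt_add_right hI (hδ n).ne'
    simpa only [I, iInf_lt_iff, exists_prop] using this
  choose μ hac hlt using hex
  have hdens := fun n => exists_density_of_jkoFunctional_ne_top (π := π) hσ (hlt n).ne_top
  choose g hg hg1 hμ using hdens
  have hδanti : ∀ {N n : ℕ}, N ≤ n → δ n ≤ δ N := fun {N n} hn => by
    refine ENNReal.ofReal_le_ofReal ?_
    have : e n ≤ e N := pow_le_pow_of_le_one (by norm_num) (by norm_num) hn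
    have := he n
    gcongr
  have hJ : ∀ {N n : ℕ}, N ≤ n → jkoFunctional σ τ π ν (μ n) ≤ I + δ N := fun {N n} hn =>
    (hlt n).le.trans (by gcongr; exact hδanti hn)
  have hcau : ∀ N n m : ℕ, N ≤ n → N ≤ m →
      eLpNorm ((fun x => (g n x).toReal) - fun x => (g m x).toReal) 1 π
        < ENNReal.ofReal (e N) := by
    intro N n m hn hm
    have h := hellingerSq_le_of_le_iInf_add (hg n) (hg m) (hg1 n) (hg1 m) (hμ n) (hμ m) (hac n)
      (hac m) hI hmin (hJ hn) (hJ hm)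
    have hH : hellingerSq π (g n) (g m) ≤ ENNReal.ofReal (e N ^ 2 / 8) := by
      have e4 : ENNReal.ofReal 4⁻¹ = 4⁻¹ := by
        rw [ENNReal.ofReal_inv_of_pos four_pos, ENNReal.ofReal_ofNat]
      simp only [δ] at h
      rw [ENNReal.ofReal_mul hσ.le, ENNReal.ofReal_mul (by norm_num), e4,
        ENNReal.mul_le_mul_iff_right (ENNReal.ofReal_pos.2 hσ).ne' ENNReal.ofReal_ne_top,
        ENNReal.mul_le_mul_iff_right (by simp) (by simp)] at h
      exact h
    have heN := he N
    refine (eLpNorm_sub_le_hellingerSq (hg n) (hg m) (hg1 n) (hg1 m)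
      (t := e N / 8) (by positivity)).trans_lt ?_
    calc _ ≤ ENNReal.ofReal (1 / (2 * (e N / 8))) * ENNReal.ofReal (e N ^ 2 / 8)
          + ENNReal.ofReal (2 * (e N / 8)) := by gcongr
      _ = ENNReal.ofReal (3 / 4 * e N) := by
        rw [← ENNReal.ofReal_mul (by positivity),
          ← ENNReal.ofReal_add (by positivity) (by positivity)]
        congr 1
        field_simp
        norm_num
      _ < _ := (ENNReal.ofReal_lt_ofReal_iff heN).2 (by linarith)
  have hB : ∑' n, ENNReal.ofReal (e n) ≠ ∞ :=
    summable_geometric_two.tsum_ofReal_ne_top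
  obtain ⟨f, hf, hf1, hlim⟩ := exists_tendsto_density hg hg1 hB hcau
  have hδ0 : Tendsto δ atTop (𝓝 0) := by
    have h1 : Tendsto e atTop (𝓝 0) :=
      tendsto_pow_atTop_nhds_zero_of_lt_one (by norm_num) (by norm_num)
    have h2 := ENNReal.tendsto_ofReal
      ((((h1.pow 2).div_const 8).const_mul 4⁻¹).const_mul σ)
    simpa using h2
  obtain ⟨m, hm, hmI⟩ := exists_jkoFunctional_le_of_tendsto (σ := σ) hτ hπ hν hf hg hf1 hg1 hμ
    hlim hI fun ε hε => ((tendsto_order.1 hδ0).2 ε hε).mono fun n hn =>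
      (hlt n).le.trans (by gcongr)
  exact ⟨m, hm, isMinOn_iff.2 fun μ hμ => hmI.trans (hmin μ hμ)⟩

end JKO

/-! ### Assembly of the two claims. -/

theorem mainTheorem5 (d : ℕ)
    -- the functional `F ∈ 𝒞¹` and its flat derivative
    (F : P2 d → ℝ) (δF : P2 d → EucSp d → ℝ) (hδF : IsFlatDerivative F δF)
    -- Wasserstein differentiability: bounded, jointly continuous Wasserstein gradient
    (hdiff : ∀ μ : P2 d, Differentiable ℝ (δF μ))
    (hbdd : ∃ C : ℝ, 0 < C ∧ ∀ (μ : P2 d) (x : EucSp d), ‖wassersteinGradient δF μ x‖ ≤ C)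
    (hcont : Continuous fun p : P2 d × EucSp d => wassersteinGradient δF p.1 p.2)
    -- Lipschitz Wasserstein gradient
    (L : ℝ) (hL : 0 < L)
    (hLip : ∀ (μ μ' : P2 d) (x x' : EucSp d),
      ‖wassersteinGradient δF μ' x' - wassersteinGradient δF μ x‖
        ≤ L * (‖x' - x‖ + (W2 μ'.toMeasure μ.toMeasure).toReal))
    -- `π ∝ e^{-U}` with `U` of class `C¹`, bounded below, with at least quadratic growth
    (U : EucSp d → ℝ) (hU : ContDiff ℝ 1 U)
    (hUbdd : ⊥ < essInf (fun x => (U x : EReal)) volume)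
    (hUgrowth : 0 < liminf (fun x => ((U x / ‖x‖ ^ 2 : ℝ) : EReal)) (cocompact (EucSp d)))
    (σ : ℝ) (hσ : 0 < σ) (τ : ℝ) (hτ : 0 < τ) (hτL : τ < 1 / L)
    (μ₀ : P2 d) (hμ₀ : μ₀ ∈ P2ac d)
    (ν₁ : Measure (EucSp d)) (hν₁ : ν₁ = μ₀.toMeasure.map (gradientStep δF τ μ₀)) :
    -- `ν₁ ∈ 𝒫₂^λ(ℝ^d)`
    (∃ ν ∈ P2ac d, ν.toMeasure = ν₁) ∧
    -- `I_d - τ ∇_μ F(μ₀)` is the (a.e. unique) optimal transport map from `μ₀` to `ν₁`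
    IsOptimalTransportMap (gradientStep δF τ μ₀) μ₀.toMeasure ν₁ ∧
    (∀ T : EucSp d → EucSp d, IsOptimalTransportMap T μ₀.toMeasure ν₁ →
      T =ᵐ[μ₀.toMeasure] gradientStep δF τ μ₀) ∧
    -- existence and uniqueness of the minimizer of the JKO step
    (∃! μ₁ : P2 d, μ₁ ∈ P2ac d ∧
      IsMinOn (jkoFunctional σ τ (gibbsMeasure U) ν₁) (P2ac d) μ₁) := by
  obtain ⟨κ, -, hκ⟩ := hδF.growth
  obtain ⟨C, -, hC⟩ := hbdd
  have hLip₀ : ∀ x x', ‖gradient (δF μ₀) x' - gradient (δF μ₀) x‖ ≤ L * ‖x' - x‖ := by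
    intro x x'
    have h := hLip μ₀ μ₀ x x'
    rwa [W2_self, ENNReal.toReal_zero, add_zero] at h
  obtain ⟨hprob, hmom, hac, hopt, huniq⟩ := gradient_descent_map (hdiff μ₀) hL hLip₀ (hκ μ₀)
    (hC μ₀) hτ hτL (μ := μ₀.toMeasure) μ₀.2.2 hμ₀ (T := gradientStep δF τ μ₀) rfl
  rw [← hν₁] at hprob hmom hac hopt huniq
  refine ⟨⟨⟨ν₁, hprob, hmom⟩, hac, rfl⟩, hopt, huniq, ?_⟩
  obtain ⟨c, hc, M, hM⟩ := exists_quadratic_lower_bound hU.continuous hUgrowth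
  obtain ⟨hπ, hπ2⟩ := gibbsMeasure_mem hU.continuous hc hM
  have hπac : gibbsMeasure U ≪ volume := tilted_absolutelyContinuous _ _
  -- The competitor `π` has zero entropy and finite transport cost. Uniqueness needs this too: if
  -- the functional were identically `∞`, every measure would minimize it.
  have hfin : ∃ μ ∈ P2ac d, jkoFunctional σ τ (gibbsMeasure U) ν₁ μ ≠ ∞ := by
    refine ⟨⟨gibbsMeasure U, hπ, hπ2⟩, hπac, ?_⟩
    change ENNReal.ofReal σ * InformationTheory.klDiv (gibbsMeasure U) (gibbsMeasure U)
      + ENNReal.ofReal (1 / (2 * τ)) * W2 (gibbsMeasure U) ν₁ ^ 2 ≠ ∞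
    rw [InformationTheory.klDiv_self, mul_zero, zero_add]
    exact ENNReal.mul_ne_top ENNReal.ofReal_ne_top (W2_sq_lt_top hπ2 hmom).ne
  obtain ⟨μ₁, hμ₁, hmin⟩ := exists_jkoFunctional_minimizer hσ hτ hπac hmom hfin
  refine ⟨μ₁, ⟨hμ₁, hmin⟩, fun μ ⟨hμ, hmin'⟩ => ?_⟩
  obtain ⟨μ', hμ', hμfin⟩ := hfin
  exact (jkoFunctional_minimizer_unique hσ hμ₁ hμ hmin hmin'
    (ne_top_of_le_ne_top hμfin (isMinOn_iff.1 hmin μ' hμ'))).symm
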